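/- Let $(\Gamma,d)$ be a countable metric space and, for every $x\in\Gamma$, let $\mathcal H_x$ be a complex Hilbert space; for finite $\Lambda\subset\Gamma$ let $\mathcal A_\Lambda=\bigotimes_{x\in\Lambda}\mathcal B(\mathcal H_x)$ be the (spatial) C*-tensor product acting on $\bigotimes_{x\in\Lambda}\mathcal H_x$, with $\mathcal A_X\subset\mathcal A_\Lambda$ for $X\subset\Lambda$ through $a\mapsto a\otimes\mathbb 1$. Let $F:[0,\infty)\to(0,\infty)$ be non-increasing with $\|F\|=\sup_x\sum_y F(d(x,y))<\infty$ and $\sup_{x,y}\sum_z F(d(x,z))F(d(y,z))/F(d(x,y))<\infty$. For $\mu>0$ put $F_\mu(r)=e^{-\mu r}F(r)$ and $C_\mu=\sup_{x,y}\sum_z F_\mu(d(x,z))F_\mu(d(y,z))/F_\mu(d(x,y))$. For $t\in\mathbb R$ and finite $Z\subset\Gamma$ let $\Phi(t,Z)=\Phi(t,Z)^*\in\mathcal A_Z$ and $L_a(t,Z)\in\mathcal A_Z$ (finitely or countably many $a$; infinite sums converge strongly), and let $$\Psi_Z(t)(A)=i[\Phi(t,Z),A]+\sum_a\Big(L_a(t,Z)^*AL_a(t,Z)-\tfrac12\{L_a(t,Z)^*L_a(t,Z),A\}\Big)$$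 define completely bounded maps of $\mathcal A_Z$, extended to $\mathcal A_\Lambda$, $\Lambda\supset Z$, as $\Psi_Z(t)\otimes\mathrm{id}$. Suppose that for every finite $\Lambda\subset\Gamma$ the generator $\mathcal L_\Lambda(t)=\sum_{Z\subset\Lambda}\Psi_Z(t)$ is norm-continuous in $t\in\mathbb R$, and that for some $\mu>0$ and some $S\subset\Gamma$ (for instance a finite set, or $S=\Gamma$) and every $t\in\mathbb R$ $$\|\Psi\|_{t,\mu}=\sup_{s\in[0,t]}\ \sup_{x,y\in S}\ \sum_{Z\subset S\text{ finite},\,Z\ni x,y}\frac{\|\Psi_Z(s)\|_{\rm cb}}{F_\mu(d(x,y))}<\infty .$$ Let $\gamma^\Lambda_{t,s}$ be the cocycle generated by $\mathcal L_\Lambda$: for $A\in\mathcal A_\Lambda$, $\gamma^\Lambda_{t,s}(A)=A(t)$, where $A'(r)=\mathcal L_\Lambda(r)A(r)$ for $r\ge s$ and $A(s)=A$. Then for every finite $\Lambda\subset S$, all $X,Y\subset\Lambda$, every completely bounded linear map $\mathcal K$ on $\mathcal A_X$ with $\mathcal K(\mathbb 1)=0$ (extended to $\mathcal A_\Lambda$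 as $\mathcal K\otimes\mathrm{id}$), every $B\in\mathcal A_Y$ and all $0\le s\le t$, $$\|\mathcal K\gamma^\Lambda_{t,s}(B)\|\le\|\mathcal K\|_{\rm cb}\|B\|\Big(\delta_Y(X)+\frac{e^{\|\Psi\|_{t,\mu}C_\mu|t-s|}-1}{C_\mu}\sum_{x\in X,\,y\in Y}F(d(x,y))\Big),$$ where $\delta_Y(X)=0$ if $X\cap Y=\emptyset$ and $\delta_Y(X)=1$ otherwise. If moreover $X\cap Y=\emptyset$, then $$\|\mathcal K\gamma^\Lambda_{t,s}(B)\|\le\frac{\|\mathcal K\|_{\rm cb}\|B\|}{C_\mu}e^{\|\Psi\|_{t,\mu}C_\mu|t-s|}\sum_{x\in X}\sum_{y\in Y}F(d(x,y)),$$ the same bound holds with $F_\mu$ in place of $F$ on the right-hand side, and, with the velocity $v=\|\Psi\|_{t,\mu}C_\mu/\mu$ and $d(X,Y)=\min_{x\in X,\,y\in Y}d(x,y)$, $$\|\mathcal K\gamma^\Lambda_{t,s}(B)\|\le\frac{\|\mathcal K\|_{\rm cb}\|B\|}{C_\mu}\,\|F\|\min(|X|,|Y|)\,e^{-\mu(d(X,Y)-v|t-s|)}.$$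 The constants $C_\mu$, $\|\Psi\|_{t,\mu}$ and $v$ do not depend on the finite set $\Lambda\subset S$. (If $X$ or $Y$ is empty, both sides of the last bound are read as $0$. If $\Gamma=\emptyset$, so that $C_\mu=0$, both sides of every bound are read as $0$.) -/

import Mathlib

open scoped ENNReal InnerProductSpace Topology
open Filter

noncomputable section

namespace LiebRobinson

/-- The Hilbert space of square-summable complex families indexed by `I`. -/
abbrev L2 (I : Type*) : Type _ := lp (fun _ : I => ℂ) 2

section Ampliation

variable {I J K : Type*} (e : I ≃ J × K)

theorem summable_sq (f : L2 I) : Summable fun i => ‖f i‖ ^ 2 := by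
  have := (lp.memℓp f).summable (by norm_num)
  simpa using this

theorem norm_sq_eq (f : L2 I) : ‖f‖ ^ 2 = ∑' i, ‖f i‖ ^ 2 := by
  have := lp.norm_rpow_eq_tsum (p := 2) (by norm_num) f
  simpa using this

theorem memL2 {f : I → ℂ} (h : Summable fun i => ‖f i‖ ^ 2) : Memℓp f 2 :=
  memℓp_gen (by simpa using h)

theorem summable_split (f : L2 I) : Summable fun p : J × K => ‖f (e.symm p)‖ ^ 2 :=
  e.symm.summable_iff.mpr (summable_sq f)

/-- The `k`-th slice of a vector of `L2 I`, where `I` is identified with `J × K`. -/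
def slice (f : L2 I) (k : K) : L2 J :=
  ⟨fun j => f (e.symm (j, k)), memL2 ((summable_split e f).comp_injective
    (i := fun j : J => (j, k)) fun _ _ h => (Prod.mk.inj h).1)⟩

@[simp] theorem slice_apply (f : L2 I) (k : K) (j : J) : slice e f k j = f (e.symm (j, k)) := rfl

theorem slice_ext {f g : L2 I} (h : ∀ k, slice e f k = slice e g k) : f = g := by
  ext i
  have := congrArg (fun v : L2 J => v (e i).1) (h (e i).2)
  simpa using this

theorem summable_slice (f : L2 I) : Summable fun k => ‖slice e f k‖ ^ 2 := by
  have h := (Equiv.prodComm K J).summable_iff.mpr (summable_split e f)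
  have := h.prod
  simpa [norm_sq_eq] using this

theorem tsum_slice (f : L2 I) : ∑' k, ‖slice e f k‖ ^ 2 = ‖f‖ ^ 2 := by
  have h := (Equiv.prodComm K J).summable_iff.mpr (summable_split e f)
  have h2 := h.tsum_prod
  rw [norm_sq_eq f, ← e.symm.tsum_eq, ← (Equiv.prodComm K J).tsum_eq]
  simp only [norm_sq_eq, slice_apply]
  exact h2.symm

theorem inner_slice (f g : L2 I) : ⟪f, g⟫_ℂ = ∑' k, ⟪slice e f k, slice e g k⟫_ℂ := by
  let u : K × J ≃ I := (Equiv.prodComm K J).trans e.symm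
  let w : I → ℂ := fun i => ⟪f i, g i⟫_ℂ
  have h0 : Summable (w ∘ u) := u.summable_iff.mpr (lp.summable_inner f g)
  have h1 : ⟪f, g⟫_ℂ = ∑' p, (w ∘ u) p := (lp.inner_eq_tsum f g).trans (u.tsum_eq w).symm
  rw [h1, h0.tsum_prod]
  exact tsum_congr fun k => (lp.inner_eq_tsum (slice e f k) (slice e g k)).symm

theorem summable_amp (T : L2 J →L[ℂ] L2 J) (f : L2 I) :
    Summable fun p : K × J => ‖T (slice e f p.1) p.2‖ ^ 2 := by
  refine (summable_prod_of_nonneg (f := fun p : K × J => ‖T (slice e f p.1) p.2‖ ^ 2)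
    fun p => sq_nonneg _).mpr ⟨fun k => summable_sq (T (slice e f k)), ?_⟩
  have : ∀ k, ∑' j, ‖T (slice e f k) j‖ ^ 2 ≤ ‖T‖ ^ 2 * ‖slice e f k‖ ^ 2 := fun k => by
    rw [← norm_sq_eq, ← mul_pow]
    exact pow_le_pow_left₀ (norm_nonneg _) (T.le_opNorm _) 2
  exact Summable.of_nonneg_of_le (fun k => tsum_nonneg fun _ => by positivity) this
    ((summable_slice e f).mul_left _)

/-- The vector `(T ⊗ 1) f`: `T` acts on each slice of `f`. -/
def ampFun (T : L2 J →L[ℂ] L2 J) (f : L2 I) : L2 I :=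
  ⟨fun i => T (slice e f (e i).2) (e i).1, memL2
    ((e.trans (Equiv.prodComm J K)).summable_iff
      (f := fun p : K × J => ‖T (slice e f p.1) p.2‖ ^ 2) |>.mpr (summable_amp e T f))⟩

theorem ampFun_apply (T : L2 J →L[ℂ] L2 J) (f : L2 I) (i : I) :
    ampFun e T f i = T (slice e f (e i).2) (e i).1 := rfl

@[simp] theorem slice_ampFun (T : L2 J →L[ℂ] L2 J) (f : L2 I) (k : K) :
    slice e (ampFun e T f) k = T (slice e f k) := by
  ext j
  simp [ampFun_apply]

theorem slice_add (f g : L2 I) (k : K) : slice e (f + g) k = slice e f k + slice e g k := rfl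

theorem slice_smul (c : ℂ) (f : L2 I) (k : K) : slice e (c • f) k = c • slice e f k := rfl

theorem norm_ampFun_le (T : L2 J →L[ℂ] L2 J) (f : L2 I) : ‖ampFun e T f‖ ≤ ‖T‖ * ‖f‖ := by
  refine le_of_sq_le_sq ?_ (by positivity)
  rw [mul_pow, ← tsum_slice e, ← tsum_slice e f, ← tsum_mul_left]
  refine (summable_slice e _).tsum_le_tsum (fun k => ?_) ((summable_slice e f).mul_left _)
  rw [slice_ampFun, ← mul_pow]
  exact pow_le_pow_left₀ (norm_nonneg _) (T.le_opNorm _) 2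

/-- The bounded operator `T ⊗ 1` on `L2 I ≅ L2 J ⊗ L2 K`. -/
def ampCLM (T : L2 J →L[ℂ] L2 J) : L2 I →L[ℂ] L2 I :=
  LinearMap.mkContinuous
    { toFun := ampFun e T
      map_add' := fun f g => slice_ext e fun k => by simp [slice_add]
      map_smul' := fun c f => slice_ext e fun k => by simp [slice_smul] }
    ‖T‖ (norm_ampFun_le e T)

@[simp] theorem slice_ampCLM (T : L2 J →L[ℂ] L2 J) (f : L2 I) (k : K) :
    slice e (ampCLM e T f) k = T (slice e f k) := slice_ampFun e T f k

theorem ampCLM_ext {S T : L2 I →L[ℂ] L2 I}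
    (h : ∀ f k, slice e (S f) k = slice e (T f) k) : S = T :=
  ContinuousLinearMap.ext fun f => slice_ext e fun k => h f k

/-- The unital star homomorphism `T ↦ T ⊗ 1` from `B(L2 J)` to `B(L2 I)`, for `I ≅ J × K`. -/
def amp : (L2 J →L[ℂ] L2 J) →⋆ₐ[ℂ] (L2 I →L[ℂ] L2 I) where
  toFun := ampCLM e
  map_one' := ampCLM_ext e fun f k => by simp
  map_mul' S T := ampCLM_ext e fun f k => by simp
  map_zero' := ampCLM_ext e fun f k => by simp; rfl
  map_add' S T := ampCLM_ext e fun f k => by simp [slice_add]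
  commutes' c := ampCLM_ext e fun f k => by
    simp [Algebra.algebraMap_eq_smul_one, slice_smul]
  map_star' T := by
    rw [ContinuousLinearMap.star_eq_adjoint, ContinuousLinearMap.star_eq_adjoint,
      ContinuousLinearMap.eq_adjoint_iff]
    intro f g
    simp only [inner_slice e, slice_ampCLM, ContinuousLinearMap.adjoint_inner_left]

theorem amp_apply (T : L2 J →L[ℂ] L2 J) (f : L2 I) (i : I) :
    amp e T f i = T (slice e f (e i).2) (e i).1 := rfl

end Ampliation

section Lattice

variable {Γ : Type*} [DecidableEq Γ] (H : Γ → Type*) [∀ x, NormedAddCommGroup (H x)]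
  [∀ x, InnerProductSpace ℂ (H x)] [∀ x, CompleteSpace (H x)]

/-- Index set of a fixed orthonormal (Hilbert) basis of the Hilbert space at the site `x`. -/
def SiteIndex (x : Γ) : Type _ := (exists_hilbertBasis ℂ (H x)).choose

/-- A fixed orthonormal (Hilbert) basis of the Hilbert space at the site `x`. -/
def siteBasis (x : Γ) : HilbertBasis (SiteIndex H x) ℂ (H x) :=
  (exists_hilbertBasis ℂ (H x)).choose_spec.choose

/-- Labels of the product orthonormal basis of the tensor product of the `H x`, `x ∈ Λ`. -/
abbrev Conf (Λ : Finset Γ) : Type _ := (x : Λ) → SiteIndex H x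

/-- The Hilbert space tensor product of the `H x`, `x ∈ Λ`, in the product orthonormal basis. -/
abbrev Space (Λ : Finset Γ) : Type _ := L2 (Conf H Λ)

/-- The embedding `a ↦ a ⊗ 1` of `B(H x)` into the bounded operators on `⨂ y ∈ Λ, H y`. -/
def siteOp (Λ : Finset Γ) (x : Λ) : (H x →L[ℂ] H x) →⋆ₐ[ℂ] (Space H Λ →L[ℂ] Space H Λ) :=
  (amp (Equiv.piSplitAt x fun y : Λ => SiteIndex H y)).comp
    (siteBasis H x).repr.conjStarAlgEquiv.toStarAlgHom

/-- The C*-algebra `⨂ x ∈ Λ, B(H x)` of observables over `Λ`: the norm closure of the star algebra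
of operators on `⨂ x ∈ Λ, H x` generated by the one-site operators. -/
def Obs (Λ : Finset Γ) : StarSubalgebra ℂ (Space H Λ →L[ℂ] Space H Λ) :=
  (StarAlgebra.adjoin ℂ (⋃ x : Λ, Set.range (siteOp H Λ x))).topologicalClosure

instance (Λ : Finset Γ) : IsClosed (Obs H Λ : Set (Space H Λ →L[ℂ] Space H Λ)) :=
  StarSubalgebra.isClosed_topologicalClosure _

/-- A configuration on `Λ` is a pair of configurations on `X ⊆ Λ` and on `Λ \ X`. -/
def splitConf {X Λ : Finset Γ} (h : X ⊆ Λ) : Conf H Λ ≃ Conf H X × Conf H (Λ \ X) where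
  toFun i := (fun x => i ⟨x, h x.2⟩, fun x => i ⟨x, (Finset.mem_sdiff.mp x.2).1⟩)
  invFun p x := if hx : (x : Γ) ∈ X then p.1 ⟨x, hx⟩
    else p.2 ⟨x, Finset.mem_sdiff.mpr ⟨x.2, hx⟩⟩
  left_inv i := by funext x; by_cases hx : (x : Γ) ∈ X <;> simp [hx]
  right_inv p := by
    refine Prod.ext (funext fun x => ?_) (funext fun x => ?_)
    · simp
    · have := (Finset.mem_sdiff.mp x.2).2
      simp [this]

theorem amp_siteOp {X Λ : Finset Γ} (h : X ⊆ Λ) (x : X) (a : H x →L[ℂ] H x) :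
    amp (splitConf H h) (siteOp H X x a) = siteOp H Λ ⟨x, h x.2⟩ a := by
  ext f i
  have key : slice (Equiv.piSplitAt x fun y : X => SiteIndex H y)
      (slice (splitConf H h) f (splitConf H h i).2)
        (Equiv.piSplitAt x (fun y : X => SiteIndex H y) (splitConf H h i).1).2 =
      slice (Equiv.piSplitAt (⟨x, h x.2⟩ : Λ) fun y : Λ => SiteIndex H y) f
        (Equiv.piSplitAt (⟨x, h x.2⟩ : Λ) (fun y : Λ => SiteIndex H y) i).2 := by
    ext j
    simp only [slice_apply]
    refine congrArg (f : Conf H Λ → ℂ) (funext fun y => ?_)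
    obtain ⟨y, hy⟩ := y
    obtain ⟨x, hx⟩ := x
    by_cases hyx : y = x
    · subst hyx
      simp [splitConf, Equiv.piSplitAt, hx]
    · by_cases hyX : y ∈ X <;> simp [splitConf, Equiv.piSplitAt, hyx, hyX]
  exact congrArg (fun v => (siteBasis H x).repr.conjStarAlgEquiv a v (i ⟨x, h x.2⟩)) key

theorem amp_mem_obs {X Λ : Finset Γ} (h : X ⊆ Λ) {a : Space H X →L[ℂ] Space H X}
    (ha : a ∈ Obs H X) : amp (splitConf H h) a ∈ Obs H Λ := by
  have hle : Obs H X ≤ (Obs H Λ).comap (amp (splitConf H h)) := by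
    refine StarSubalgebra.topologicalClosure_minimal ?_ ?_
    · rw [StarAlgebra.adjoin_le_iff]
      rintro _ ⟨_, ⟨x, rfl⟩, b, rfl⟩
      refine StarSubalgebra.le_topologicalClosure _ ?_
      refine StarAlgebra.subset_adjoin ℂ _ (Set.mem_iUnion.mpr ⟨⟨x, h x.2⟩, b, ?_⟩)
      exact (amp_siteOp H h x b).symm
    · exact (StarSubalgebra.isClosed_topologicalClosure _).preimage
        (map_continuous (amp (splitConf H h)))
  exact hle ha

/-- The identification `a ↦ a ⊗ 1` of `Obs H X` with a subalgebra of `Obs H Λ`, for `X ⊆ Λ`. -/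
def embed {X Λ : Finset Γ} (h : X ⊆ Λ) : Obs H X →⋆ₐ[ℂ] Obs H Λ :=
  ((amp (splitConf H h)).comp (Obs H X).subtype).codRestrict (Obs H Λ)
    fun a => amp_mem_obs H h a.2

end Lattice

section CompletelyBounded

variable {A : Type*} [CStarAlgebra A]

/-- The cb-norm `sup_n ‖Ψ ⊗ id‖` of a bounded linear map, where `Ψ ⊗ id` acts entrywise on the
C*-algebra of `n × n` matrices over `A`. It is `∞` exactly if `Ψ` is not completely bounded. -/
def cbNorm (Ψ : A →L[ℂ] A) : ℝ≥0∞ :=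
  letI := CStarAlgebra.spectralOrder A
  letI := CStarAlgebra.spectralOrderedRing A
  ⨆ (n : ℕ) (M : CStarMatrix (Fin n) (Fin n) A) (_ : ‖M‖ ≤ 1), ENNReal.ofReal ‖M.map Ψ‖

/-- The Lindblad expression `i[Φ, a] + ∑ m < n, (Vₘ* a Vₘ - ½ {Vₘ* Vₘ, a})`. -/
def lindblad (Φ : A) (V : ℕ → A) (n : ℕ) (a : A) : A :=
  Complex.I • (Φ * a - a * Φ) + ∑ m ∈ Finset.range n,
    (star (V m) * a * V m - (1 / 2 : ℂ) • (star (V m) * V m * a + a * (star (V m) * V m)))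

end CompletelyBounded

section Dynamics

variable {Γ : Type*} [DecidableEq Γ] (H : Γ → Type*) [∀ x, NormedAddCommGroup (H x)]
  [∀ x, InnerProductSpace ℂ (H x)] [∀ x, CompleteSpace (H x)]

/-- A time-dependent family of local terms in Lindblad form: a self-adjoint interaction `Φ t Z`,
operators `V t Z a ∈ Obs H Z` (finitely many of them are a sequence that is eventually zero), and
the resulting completely bounded maps `Ψ t Z` of `Obs H Z`, where an infinite sum over `a` is
understood as the limit of its partial sums in the strong operator topology. -/
structure LindbladFamily where
  /-- the Hamiltonian interaction -/
  Φ : ℝ → (Z : Finset Γ) → Obs H Z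
  /-- the Lindblad operators -/
  V : ℝ → (Z : Finset Γ) → ℕ → Obs H Z
  /-- the local terms of the generator -/
  Ψ : ℝ → (Z : Finset Γ) → Obs H Z →L[ℂ] Obs H Z
  selfAdjoint : ∀ t Z, star (Φ t Z) = Φ t Z
  tendsto : ∀ t Z (a : Obs H Z) (ξ : Space H Z),
    Tendsto (fun n => ((lindblad (Φ t Z) (V t Z) n a : Obs H Z) : Space H Z →L[ℂ] Space H Z) ξ) atTop
      (𝓝 ((Ψ t Z a : Space H Z →L[ℂ] Space H Z) ξ))
  completelyBounded : ∀ t Z, cbNorm (Ψ t Z) < ∞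

variable {H}

open Classical in
/-- The map `K ⊗ id` on `Obs H Λ = Obs H X ⊗ Obs H (Λ \ X)`: the bounded linear map that sends
`a ⊗ b` to `K a ⊗ b`. It exists for every completely bounded `K`, and it is unique because the
span of the `a ⊗ b` is dense. -/
def amplify {X Λ : Finset Γ} (h : X ⊆ Λ) (K : Obs H X →L[ℂ] Obs H X) : Obs H Λ →L[ℂ] Obs H Λ :=
  if hK : ∃ K' : Obs H Λ →L[ℂ] Obs H Λ, ∀ (a : Obs H X) (b : Obs H (Λ \ X)),
      K' (embed H h a * embed H Finset.sdiff_subset b) =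
        embed H h (K a) * embed H Finset.sdiff_subset b
  then hK.choose else 0

/-- The finite-volume generator `∑ Z ⊆ Λ, Ψ_Z(t)` on `Obs H Λ`. -/
def LindbladFamily.generator (𝓛 : LindbladFamily H) (Λ : Finset Γ) (t : ℝ) :
    Obs H Λ →L[ℂ] Obs H Λ :=
  ∑ Z ∈ Λ.powerset.attach, amplify (Finset.mem_powerset.mp Z.2) (𝓛.Ψ t Z)

open Classical in
/-- The propagator of a family `L` of bounded operators: `propagator L t s a` is the value at time
`t ≥ s` of the (for norm-continuous `L` existing and unique) solution of `A' = L(r) A`, `r ≥ s`,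
with `A(s) = a`. -/
def propagator {E : Type*} [NormedAddCommGroup E] [NormedSpace ℂ E] (L : ℝ → E →L[ℂ] E)
    (t s : ℝ) (a : E) : E :=
  if h : ∃ A : ℝ → E, A s = a ∧ ∀ r ∈ Set.Ici s, HasDerivWithinAt A (L r (A r)) (Set.Ici s) r
  then h.choose t else 0

/-- The finite-volume cocycle `γ^Λ_{t,s}`. -/
def LindbladFamily.cocycle (𝓛 : LindbladFamily H) (Λ : Finset Γ) (t s : ℝ) :
    Obs H Λ → Obs H Λ :=
  propagator (𝓛.generator Λ) t s

end Dynamics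

section Decay

variable (Γ : Type*) [MetricSpace Γ]

/-- `‖F‖ = sup_x ∑_y F(d(x,y))`. -/
def uniformSum (F : ℝ → ℝ) : ℝ≥0∞ := ⨆ x : Γ, ∑' y : Γ, ENNReal.ofReal (F (dist x y))

/-- `sup_{x,y} ∑_z F(d(x,z)) F(d(y,z)) / F(d(x,y))`. -/
def convConst (F : ℝ → ℝ) : ℝ≥0∞ :=
  ⨆ (x : Γ) (y : Γ), ∑' z : Γ, ENNReal.ofReal (F (dist x z) * F (dist y z) / F (dist x y))

/-- `F` is a positive non-increasing function on `[0, ∞)` that is uniformly integrable over `Γ`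
and satisfies the convolution condition. -/
structure IsDecayFunction (F : ℝ → ℝ) : Prop where
  pos : ∀ r, 0 ≤ r → 0 < F r
  anti : AntitoneOn F (Set.Ici 0)
  uniformSum_lt_top : uniformSum Γ F < ∞
  convConst_lt_top : convConst Γ F < ∞

/-- `F_μ(r) = e^{-μ r} F(r)`. -/
def expWeight (μ : ℝ) (F : ℝ → ℝ) (r : ℝ) : ℝ := Real.exp (-μ * r) * F r

variable {Γ}

/-- The distance `d(X, Y)` of two nonempty finite sets. -/
def setDist (X Y : Finset Γ) : ℝ := sInf {r | ∃ x ∈ X, ∃ y ∈ Y, r = dist x y}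

variable [DecidableEq Γ] {H : Γ → Type*} [∀ x, NormedAddCommGroup (H x)]
  [∀ x, InnerProductSpace ℂ (H x)] [∀ x, CompleteSpace (H x)]

/-- `‖Ψ‖_{t,μ} = sup_{s ∈ [0,t]} sup_{x,y ∈ S} ∑_{Z ∋ x,y} ‖Ψ_Z(s)‖_cb / F_μ(d(x,y))`, where `Z`
runs over the finite subsets of `S`. -/
def LindbladFamily.decayNorm (𝓛 : LindbladFamily H) (F : ℝ → ℝ) (μ : ℝ) (S : Set Γ) (t : ℝ) :
    ℝ≥0∞ :=
  ⨆ s ∈ Set.Icc 0 t, ⨆ x ∈ S, ⨆ y ∈ S,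
    ∑' Z : {Z : Finset Γ // (Z : Set Γ) ⊆ S ∧ x ∈ Z ∧ y ∈ Z},
      cbNorm (𝓛.Ψ s Z) / ENNReal.ofReal (expWeight μ F (dist x y))

end Decay

end LiebRobinson

end

/-! Let `A(r)` solve the evolution equation with `A(s) = B`, and follow `f(r) = K A(r)`. The terms
of the generator supported off `X` commute with `K`, so `f' = M f + g`, where `M` collects these
terms and `g` is the sum of `K Ψ_Z A(r)` over the sets `Z` that meet `X`. Since `M` is dissipative
it does not increase the norm, hence `‖f(r)‖ ≤ ‖f(s)‖ + ∫ ‖g‖`. For disjoint `X` and `Y` the initial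
value vanishes because `K 1 = 0`. Each `Ψ_Z` is itself completely bounded and kills `1`, so the same
estimate applies to `Ψ_Z A(r)` and can be iterated (`LindbladFamily.norm_amplify_le_of_deriv`).

The iteration needs no sums over chains of sets. The ansatz `‖B‖ (δ + E(r) ∑ F_μ)` with `E' = N (1 +
C E)`, `E(s) = 0`, reproduces itself under one step by the convolution condition (`sum_weights_le`).
The crude a priori bound that starts the induction contributes an error of order `(N C (r - s))^n /
n!`, which tends to zero (`LindbladFamily.norm_amplify_le_exp`).

Two facts carry this. First, `‖K ⊗ id‖ ≤ ‖K‖_cb`: an operator on a tensor product is a matrix of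
operators on the first factor, its finite blocks are C*-matrices, and `K` acts on them entrywise
(`norm_le_cbNorm_mul`). The same picture yields the existence of `K ⊗ id` (`exists_amplify`).
Second, the Lindblad form gives `Ψ(a* a) ≥ Ψ(a)* a + a* Ψ(a)`, and this alone forces `‖1 + ε Ψ‖ ≤ 1
+ O(ε²)` (`IsDissipative.norm_add_smul_le`). That is enough to compare right derivatives of norms
(`norm_le_of_dissipative`), so no propagator of `M` has to be constructed. -/

noncomputable section

namespace LiebRobinson

/-! ### Operators on a tensor product as matrices of operators. -/

section Tensor

variable {I J K : Type*} (e : I ≃ J × K)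

theorem summable_tensor (g : L2 J) (h : L2 K) :
    Summable fun i => ‖g (e i).1 * h (e i).2‖ ^ 2 := by
  have := (summable_sq g).mul_of_nonneg (summable_sq h) (fun _ => sq_nonneg _)
    (fun _ => sq_nonneg _)
  refine (e.summable_iff (f := fun p : J × K => ‖g p.1 * h p.2‖ ^ 2)).mpr ?_
  simpa [mul_pow] using this

/-- The elementary tensor `g ⊗ h` in `L2 I ≅ L2 J ⊗ L2 K`. -/
def tensor (g : L2 J) (h : L2 K) : L2 I :=
  ⟨fun i => g (e i).1 * h (e i).2, memL2 (summable_tensor e g h)⟩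

theorem tensor_apply (g : L2 J) (h : L2 K) (i : I) :
    tensor e g h i = g (e i).1 * h (e i).2 := rfl

theorem slice_tensor (g : L2 J) (h : L2 K) (k : K) : slice e (tensor e g h) k = h k • g := by
  ext j
  simp [tensor_apply, mul_comm]

/-- The `k`-th slice as a bounded operator. -/
def sliceCLM (k : K) : L2 I →L[ℂ] L2 J :=
  LinearMap.mkContinuous
    { toFun := fun f => slice e f k
      map_add' := fun f g => slice_add e f g k
      map_smul' := fun c f => slice_smul e c f k } 1 fun f => by
    rw [one_mul]
    refine le_of_sq_le_sq ?_ (norm_nonneg _)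
    rw [← tsum_slice e f]
    exact (summable_slice e f).le_tsum k fun _ _ => sq_nonneg _

@[simp] theorem sliceCLM_apply (k : K) (f : L2 I) : sliceCLM e k f = slice e f k := rfl

/-- The isometry `g ↦ g ⊗ δ_k`. -/
def insertCLM (k : K) : L2 J →L[ℂ] L2 I := ContinuousLinearMap.adjoint (sliceCLM e k)

open Classical in
theorem insertCLM_apply (k : K) (g : L2 J) :
    insertCLM e k g = tensor e g (lp.single 2 k (1 : ℂ)) := by
  refine ext_inner_right ℂ fun f => ?_
  rw [insertCLM, ContinuousLinearMap.adjoint_inner_left, inner_slice e, tsum_eq_single k]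
  · simp [slice_tensor]
  · intro l hl
    simp [slice_tensor, Pi.single_eq_of_ne hl]

theorem slice_insertCLM_self (k : K) (g : L2 J) : slice e (insertCLM e k g) k = g := by
  classical
  simp [insertCLM_apply, slice_tensor]

theorem slice_insertCLM_ne {k l : K} (h : k ≠ l) (g : L2 J) :
    slice e (insertCLM e l g) k = 0 := by
  classical
  simp [insertCLM_apply, slice_tensor, Pi.single_eq_of_ne h]

theorem adjoint_insertCLM (k : K) :
    ContinuousLinearMap.adjoint (insertCLM e k) = sliceCLM e k :=
  ContinuousLinearMap.adjoint_adjoint _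

theorem slice_sum {α : Type*} (s : Finset α) (f : α → L2 I) (k : K) :
    slice e (∑ a ∈ s, f a) k = ∑ a ∈ s, slice e (f a) k :=
  map_sum (sliceCLM e k) f s

/-- The squared distance from a partial sum to `f` is the tail of the convergent series `∑ ‖slice e
f k‖ ^ 2`. -/
theorem hasSum_insertCLM (f : L2 I) : HasSum (fun k => insertCLM e k (slice e f k)) f := by
  classical
  rw [HasSum, SummationFilter.unconditional_filter, tendsto_iff_norm_sub_tendsto_zero]
  have key : ∀ F : Finset K, ‖∑ k ∈ F, insertCLM e k (slice e f k) - f‖ ^ 2 =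
      ∑' k : {k // k ∉ F}, ‖slice e f k‖ ^ 2 := by
    intro F
    have h1 : ∀ k, slice e (∑ k ∈ F, insertCLM e k (slice e f k) - f) k =
        if k ∈ F then 0 else - slice e f k := by
      intro k
      have : slice e (∑ k ∈ F, insertCLM e k (slice e f k) - f) k =
        slice e (∑ k ∈ F, insertCLM e k (slice e f k)) k - slice e f k := rfl
      rw [this, slice_sum]
      split_ifs with hk
      · rw [Finset.sum_eq_single_of_mem k hk fun l _ hl => slice_insertCLM_ne e hl.symm _,
          slice_insertCLM_self, sub_self]
      · rw [Finset.sum_eq_zero fun l hl =>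
          slice_insertCLM_ne e (ne_of_mem_of_not_mem hl hk).symm _, zero_sub]
    rw [← tsum_slice e]
    simp only [h1]
    rw [← tsum_subtype_eq_of_support_subset (s := {k | k ∉ F})]
    · refine tsum_congr fun k => ?_
      rw [if_neg k.2, norm_neg]
    · intro k hk hkF
      simp [hkF] at hk
  have h2 : Tendsto (fun F : Finset K => ‖∑ k ∈ F, insertCLM e k (slice e f k) - f‖ ^ 2)
      atTop (𝓝 0) := by
    simp only [key]
    exact tendsto_tsum_compl_atTop_zero fun k => ‖slice e f k‖ ^ 2
  have := (Real.continuous_sqrt.tendsto 0).comp h2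
  simpa [Function.comp_def, Real.sqrt_sq] using this

theorem ext_insertCLM {E : Type*} [NormedAddCommGroup E] [NormedSpace ℂ E] {S T : L2 I →L[ℂ] E}
    (h : ∀ k g, S (insertCLM e k g) = T (insertCLM e k g)) : S = T := by
  ext1 f
  have h1 := (hasSum_insertCLM e f).mapL S
  have h2 := (hasSum_insertCLM e f).mapL T
  simp only [h] at h1
  exact h1.unique h2

/-- The operator-valued matrix coefficient of `T` with respect to `L2 I ≅ L2 J ⊗ L2 K`. -/
def coeff (k l : K) : (L2 I →L[ℂ] L2 I) →L[ℂ] (L2 J →L[ℂ] L2 J) :=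
  (ContinuousLinearMap.compL ℂ (L2 J) (L2 I) (L2 J) (sliceCLM e k)).comp
    ((ContinuousLinearMap.compL ℂ (L2 J) (L2 I) (L2 I)).flip (insertCLM e l))

@[simp] theorem coeff_apply (k l : K) (T : L2 I →L[ℂ] L2 I) (g : L2 J) :
    coeff e k l T g = slice e (T (insertCLM e l g)) k := rfl

theorem coeff_ext {S T : L2 I →L[ℂ] L2 I} (h : ∀ k l, coeff e k l S = coeff e k l T) : S = T :=
  ext_insertCLM e fun l g => slice_ext e fun k => congrArg (fun R => R g) (h k l)

theorem coeff_amp_mul (a : L2 J →L[ℂ] L2 J) (T : L2 I →L[ℂ] L2 I) (k l : K) :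
    coeff e k l (amp e a * T) = a * coeff e k l T := by
  ext1 g
  exact slice_ampCLM e a _ k

/-- `T ⊗ 1` does not depend on how the complementary factor is labelled. This is needed because
complements such as `Λ \ (Λ \ X)` and `X` are different index types. -/
theorem amp_congr {K' : Type*} {e : I ≃ J × K} {e' : I ≃ J × K'} (h : ∀ i, (e i).1 = (e' i).1)
    (h' : ∀ i j, e.symm (j, (e i).2) = e'.symm (j, (e' i).2)) : amp e = amp e' := by
  ext T f i
  rw [amp_apply, amp_apply, h]
  have : slice e f (e i).2 = slice e' f (e' i).2 := by
    ext j
    simp [h']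
  rw [this]

theorem amp_tensor (a : L2 J →L[ℂ] L2 J) (g : L2 J) (h : L2 K) :
    amp e a (tensor e g h) = tensor e (a g) h := by
  refine slice_ext e fun k => ?_
  rw [slice_tensor, ← map_smul, ← slice_tensor]
  exact slice_ampCLM e a _ k

theorem amp_swap_tensor (b : L2 K →L[ℂ] L2 K) (g : L2 J) (h : L2 K) :
    amp (e.trans (Equiv.prodComm J K)) b (tensor e g h) = tensor e g (b h) := by
  have : ∀ h, tensor e g h = tensor (e.trans (Equiv.prodComm J K)) h g := fun h => by
    ext i
    simp [tensor_apply, mul_comm]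
  rw [this, this, amp_tensor]

theorem amp_commute_swap (a : L2 J →L[ℂ] L2 J) (b : L2 K →L[ℂ] L2 K) :
    Commute (amp e a) (amp (e.trans (Equiv.prodComm J K)) b) := by
  classical
  refine ext_insertCLM e fun k g => ?_
  simp only [mul_apply_eq_comp, insertCLM_apply, amp_tensor, amp_swap_tensor]

/-- The scalar is the matrix element of `b` in the standard basis; it makes every coefficient of `a
⊗ b` a multiple of `a`. -/
theorem coeff_amp_swap (b : L2 K →L[ℂ] L2 K) (k l : K) :
    ∃ c : ℂ, coeff e k l (amp (e.trans (Equiv.prodComm J K)) b) = c • 1 := by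
  classical
  refine ⟨b (lp.single 2 l (1 : ℂ)) k, ?_⟩
  ext1 g
  rw [coeff_apply, insertCLM_apply, amp_swap_tensor, slice_tensor]
  rfl

/-- Ampliation is sequentially strong-operator continuous. -/
theorem tendsto_amp {T : ℕ → L2 J →L[ℂ] L2 J} {S : L2 J →L[ℂ] L2 J}
    (h : ∀ g, Tendsto (fun n => T n g) atTop (𝓝 (S g))) (f : L2 I) :
    Tendsto (fun n => amp e (T n) f) atTop (𝓝 (amp e S f)) := by
  -- The uniform bound on `T n - S` supplies the dominating sequence for the sum over slices.
  obtain ⟨C, hC⟩ := banach_steinhaus (g := fun n => T n - S) fun g =>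
    (((h g).sub_const (S g)).norm.bddAbove_range).imp fun C hC n => hC ⟨n, rfl⟩
  rw [tendsto_iff_norm_sub_tendsto_zero]
  have h2 : Tendsto (fun n => ∑' k, ‖(T n - S) (slice e f k)‖ ^ 2) atTop (𝓝 (∑' _ : K, 0)) := by
    refine tendsto_tsum_of_dominated_convergence ((summable_slice e f).mul_left (C ^ 2)) ?_ ?_
    · intro k
      have := (((h (slice e f k)).sub_const (S (slice e f k))).norm.pow 2)
      simpa using this
    · refine Eventually.of_forall fun n k => ?_
      rw [Real.norm_of_nonneg (sq_nonneg _), ← mul_pow]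
      exact pow_le_pow_left₀ (norm_nonneg _) ((T n - S).le_of_opNorm_le (hC n) _) 2
  have h3 : ∀ n, ∑' k, ‖(T n - S) (slice e f k)‖ ^ 2 = ‖amp e (T n) f - amp e S f‖ ^ 2 := by
    intro n
    rw [← sub_apply, ← map_sub, ← tsum_slice e]
    exact tsum_congr fun k => by rw [← slice_ampCLM e]; rfl
  simp only [h3, tsum_zero] at h2
  have := (Real.continuous_sqrt.tendsto 0).comp h2
  simpa [Function.comp_def, Real.sqrt_sq] using this

end Tensor

/-! ### Finite blocks and C*-matrices. -/

section MatrixAction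

variable {I J K : Type*} (e : I ≃ J × K)

variable {A : StarSubalgebra ℂ (L2 J →L[ℂ] L2 J)} {n : ℕ} {ι : Fin n → K}

/-- The operator on `L2 I ≅ L2 J ⊗ L2 K` with the matrix `M` of coefficients in the block
given by `ι`. -/
def blockOp (ι : Fin n → K) (M : CStarMatrix (Fin n) (Fin n) A) : L2 I →L[ℂ] L2 I :=
  ∑ i, ∑ j, insertCLM e (ι i) ∘L (M i j : L2 J →L[ℂ] L2 J) ∘L sliceCLM e (ι j)

theorem coeff_blockOp (hι : Function.Injective ι) (M : CStarMatrix (Fin n) (Fin n) A)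
    (i j : Fin n) : coeff e (ι i) (ι j) (blockOp e ι M) = M i j := by
  ext1 g
  simp only [coeff_apply, blockOp, sum_apply, slice_sum,
    ContinuousLinearMap.comp_apply, sliceCLM_apply]
  rw [Finset.sum_eq_single i, Finset.sum_eq_single j, slice_insertCLM_self, slice_insertCLM_self]
  · intro j' _ hj'
    rw [slice_insertCLM_ne e (hι.ne hj') g]
    simpa using (sliceCLM e (ι i)).map_zero
  · simp
  · intro i' _ hi'
    exact Finset.sum_eq_zero fun j' _ => slice_insertCLM_ne e (hι.ne hi'.symm) _
  · simp

theorem blockOp_mul (hι : Function.Injective ι) (M N : CStarMatrix (Fin n) (Fin n) A) :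
    blockOp e ι (M * N) = blockOp e ι M * blockOp e ι N := by
  have key : ∀ i j i' j', (insertCLM e (ι i) ∘L (M i j : L2 J →L[ℂ] L2 J) ∘L sliceCLM e (ι j)) *
      (insertCLM e (ι i') ∘L (N i' j' : L2 J →L[ℂ] L2 J) ∘L sliceCLM e (ι j')) =
      if j = i' then insertCLM e (ι i) ∘L ((M i j : L2 J →L[ℂ] L2 J) * (N j j' : L2 J →L[ℂ] L2 J)) ∘L sliceCLM e (ι j')
      else 0 := by
    intro i j i' j'
    ext1 f
    split_ifs with h
    · subst h
      simp [slice_insertCLM_self]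
    · simp only [mul_apply_eq_comp, ContinuousLinearMap.comp_apply, sliceCLM_apply,
        slice_insertCLM_ne e (hι.ne h), map_zero, zero_apply]
  simp only [blockOp, Finset.sum_mul, Finset.mul_sum, key, CStarMatrix.mul_apply]
  simp only [Finset.sum_ite_eq', Finset.mem_univ, if_true]
  rw [Finset.sum_comm]
  conv_rhs => rw [Finset.sum_comm]
  refine Finset.sum_congr rfl fun j _ => ?_
  rw [Finset.sum_comm]
  refine Finset.sum_congr rfl fun i _ => ?_
  ext1 f
  simp [sum_apply]

theorem star_blockOp (M : CStarMatrix (Fin n) (Fin n) A) :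
    blockOp e ι (star M) = star (blockOp e ι M) := by
  simp only [blockOp, star_sum]
  rw [Finset.sum_comm]
  refine Finset.sum_congr rfl fun j _ => Finset.sum_congr rfl fun i _ => ?_
  simp only [ContinuousLinearMap.star_eq_adjoint, ContinuousLinearMap.adjoint_comp,
    adjoint_insertCLM, CStarMatrix.star_apply]
  rfl

/-- The block operators form an injective star homomorphism. -/
def blockHom (hι : Function.Injective ι) :
    CStarMatrix (Fin n) (Fin n) A →⋆ₙₐ[ℂ] (L2 I →L[ℂ] L2 I) where
  toFun := blockOp e ι
  map_smul' c M := by simp [blockOp, Finset.smul_sum]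
  map_zero' := by simp [blockOp]
  map_add' M N := by simp [blockOp, Finset.sum_add_distrib]
  map_mul' := blockOp_mul e hι
  map_star' := star_blockOp e

/-- An injective star homomorphism of C*-algebras is isometric, and `M` can be read off from the
coefficients of its block operator. -/
theorem norm_blockOp [IsClosed (A : Set (L2 J →L[ℂ] L2 J))] [PartialOrder A] [StarOrderedRing A]
    (hι : Function.Injective ι)
    (M : CStarMatrix (Fin n) (Fin n) A) : ‖blockOp e ι M‖ = ‖M‖ := by
  refine NonUnitalStarAlgHom.norm_map (blockHom e hι) (fun M N h => ?_) M
  refine CStarMatrix.ext fun i j => Subtype.ext ?_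
  rw [← coeff_blockOp e hι M, ← coeff_blockOp e hι N]
  exact congrArg _ h

/-- The projection onto the block given by `ι`. -/
def blockProj (ι : Fin n → K) : L2 I →L[ℂ] L2 I :=
  ∑ i, insertCLM e (ι i) ∘L sliceCLM e (ι i)

theorem norm_blockProj_le (hι : Function.Injective ι) : ‖blockProj e ι‖ ≤ 1 := by
  refine ContinuousLinearMap.opNorm_le_bound _ zero_le_one fun f => ?_
  rw [one_mul]
  refine le_of_sq_le_sq ?_ (norm_nonneg _)
  rw [← tsum_slice e, ← tsum_slice e f]
  refine (summable_slice e _).tsum_le_tsum (fun k => ?_) (summable_slice e f)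
  refine pow_le_pow_left₀ (norm_nonneg _) ?_ 2
  simp only [blockProj, sum_apply, slice_sum, ContinuousLinearMap.comp_apply,
    sliceCLM_apply]
  by_cases hk : ∃ i, ι i = k
  · obtain ⟨i, rfl⟩ := hk
    rw [Finset.sum_eq_single i, slice_insertCLM_self]
    · intro j _ hj
      exact slice_insertCLM_ne e (hι.ne hj.symm) _
    · simp
  · rw [Finset.sum_eq_zero fun i _ => slice_insertCLM_ne e (fun h => hk ⟨i, h.symm⟩) _, norm_zero]
    exact norm_nonneg _

theorem blockProj_mul_mul (T : L2 I →L[ℂ] L2 I) (M : CStarMatrix (Fin n) (Fin n) A)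
    (h : ∀ i j, coeff e (ι i) (ι j) T = M i j) :
    blockProj e ι * T * blockProj e ι = blockOp e ι M := by
  simp only [blockProj, blockOp, Finset.sum_mul, Finset.mul_sum, ← h]
  rw [Finset.sum_comm]
  rfl

/-- An operator all of whose block compressions are bounded by `c` is bounded by `c`. -/
theorem norm_le_of_blockProj {T : L2 I →L[ℂ] L2 I} {c : ℝ}
    (h : ∀ (n : ℕ) (ι : Fin n → K), Function.Injective ι →
      ‖blockProj e ι * T * blockProj e ι‖ ≤ c) : ‖T‖ ≤ c := by
  have hP : ∀ F : Finset K, ∃ (n : ℕ) (ι : Fin n → K), Function.Injective ι ∧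
      ∀ f, blockProj e ι f = ∑ k ∈ F, insertCLM e k (slice e f k) := fun F => by
    refine ⟨F.card, fun i => F.equivFin.symm i,
      Subtype.val_injective.comp F.equivFin.symm.injective, fun f => ?_⟩
    rw [blockProj, sum_apply, ← Finset.sum_coe_sort F]
    exact F.equivFin.symm.sum_comp fun k : F => insertCLM e k (slice e f k)
  choose n ι hι hsum using hP
  have hlim : ∀ f, Tendsto (fun F => blockProj e (ι F) f) atTop (𝓝 f) := fun f => by
    simp only [hsum]
    exact hasSum_insertCLM e f
  -- The empty block already forces `c` to be nonnegative.
  have hc : 0 ≤ c := (norm_nonneg _).trans (h 0 Fin.elim0 fun i => i.elim0)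
  refine ContinuousLinearMap.opNorm_le_bound _ hc fun f => ?_
  have h1 : Tendsto (fun F => (blockProj e (ι F) * T * blockProj e (ι F)) f) atTop (𝓝 (T f)) := by
    -- Write `P T P f = P T (P f - f) + P T f`; the first summand vanishes in the limit because `‖P‖
    -- ≤ 1`.
    have h2 : Tendsto (fun F => blockProj e (ι F) (T (blockProj e (ι F) f - f))) atTop (𝓝 0) := by
      have h3 : Tendsto (fun F => ‖T (blockProj e (ι F) f - f)‖) atTop (𝓝 0) := by
        have := ((T.continuous.tendsto _).comp ((hlim f).sub_const f)).norm
        simpa using this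
      refine squeeze_zero_norm (fun F => ?_) h3
      have := (blockProj e (ι F)).le_of_opNorm_le (norm_blockProj_le e (hι F))
        (T (blockProj e (ι F) f - f))
      rwa [one_mul] at this
    have := h2.add (hlim (T f))
    simpa [mul_apply_eq_comp] using this
  exact le_of_tendsto h1.norm (Eventually.of_forall fun F =>
    ContinuousLinearMap.le_of_opNorm_le _ (h _ _ (hι F)) f)

end MatrixAction

/-! ### The cb-norm controls entrywise action on operators. -/

section CbNorm

theorem norm_map_le {A : Type*} [CStarAlgebra A] (Ψ : A →L[ℂ] A) (hΨ : cbNorm Ψ < ∞) {n : ℕ}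
    (M : CStarMatrix (Fin n) (Fin n) A) :
    letI := CStarAlgebra.spectralOrder A
    letI := CStarAlgebra.spectralOrderedRing A
    ‖M.map Ψ‖ ≤ (cbNorm Ψ).toReal * ‖M‖ := by
  let := CStarAlgebra.spectralOrder A
  let := CStarAlgebra.spectralOrderedRing A
  have key : ∀ N : CStarMatrix (Fin n) (Fin n) A, ‖N‖ ≤ 1 → ‖N.map Ψ‖ ≤ (cbNorm Ψ).toReal := by
    intro N hN
    refine (ENNReal.ofReal_le_iff_le_toReal hΨ.ne).mp ?_
    exact le_iSup_of_le n (le_iSup_of_le N (le_iSup_of_le hN le_rfl))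
  have hsmul : ∀ (c : ℂ) (N : CStarMatrix (Fin n) (Fin n) A), (c • N).map Ψ = c • N.map Ψ :=
    fun c N => CStarMatrix.ext fun i j => map_smul Ψ c (N i j)
  rcases eq_or_ne M 0 with rfl | hM
  · have : (0 : CStarMatrix (Fin n) (Fin n) A).map Ψ = 0 :=
      CStarMatrix.ext fun i j => map_zero Ψ
    rw [this, norm_zero, mul_zero]
  · have hM' : 0 < ‖M‖ := norm_pos_iff.mpr hM
    have := key (((‖M‖⁻¹ : ℝ) : ℂ) • M) (by
      rw [norm_smul, Complex.norm_real, Real.norm_of_nonneg (by positivity),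
        inv_mul_cancel₀ hM'.ne'])
    rw [hsmul, norm_smul, Complex.norm_real, Real.norm_of_nonneg (by positivity),
      inv_mul_le_iff₀ hM'] at this
    rwa [mul_comm]

/-- If the matrix coefficients of `T'` are the images under `Ψ` of those of `T`, then
`‖T'‖ ≤ ‖Ψ‖_cb ‖T‖`. -/
theorem norm_le_cbNorm_mul {I J K : Type*} (e : I ≃ J × K)
    {A : StarSubalgebra ℂ (L2 J →L[ℂ] L2 J)} [IsClosed (A : Set (L2 J →L[ℂ] L2 J))]
    (Ψ : A →L[ℂ] A) (hΨ : cbNorm Ψ < ∞) (T T' : L2 I →L[ℂ] L2 I) (M : K → K → A)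
    (hT : ∀ k l, coeff e k l T = M k l) (hT' : ∀ k l, coeff e k l T' = Ψ (M k l)) :
    ‖T'‖ ≤ (cbNorm Ψ).toReal * ‖T‖ := by
  let := CStarAlgebra.spectralOrder A
  let := CStarAlgebra.spectralOrderedRing A
  -- On a finite block the claim is the definition of the cb-norm, and compressing `T` to the block
  -- does not increase its norm.
  refine norm_le_of_blockProj e fun n ι hι => ?_
  let N : CStarMatrix (Fin n) (Fin n) A := CStarMatrix.ofMatrix fun i j => M (ι i) (ι j)
  rw [blockProj_mul_mul e T' (N.map Ψ) fun i j => hT' _ _, norm_blockOp e hι]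
  refine (norm_map_le Ψ hΨ N).trans ?_
  refine mul_le_mul_of_nonneg_left ?_ ENNReal.toReal_nonneg
  rw [← norm_blockOp e hι, ← blockProj_mul_mul e T N fun i j => hT _ _]
  have hP := norm_blockProj_le e hι
  calc _ ≤ ‖blockProj e ι‖ * ‖T‖ * ‖blockProj e ι‖ :=
        (norm_mul_le _ _).trans (mul_le_mul_of_nonneg_right (norm_mul_le _ _) (norm_nonneg _))
    _ ≤ 1 * ‖T‖ * 1 := by gcongr
    _ = ‖T‖ := by ring

end CbNorm

/-! ### Local algebras, their embeddings and matrix coefficients. -/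

section Lattice

variable {Γ : Type*} [DecidableEq Γ] {H : Γ → Type*} [∀ x, NormedAddCommGroup (H x)]
  [∀ x, InnerProductSpace ℂ (H x)] [∀ x, CompleteSpace (H x)]

theorem coe_embed {X Λ : Finset Γ} (h : X ⊆ Λ) (a : Obs H X) :
    (embed H h a : Space H Λ →L[ℂ] Space H Λ) = amp (splitConf H h) a := rfl

/-- The one-site operators as elements of `Obs H Λ`. -/
def siteObs (Λ : Finset Γ) (x : Λ) (a : H x →L[ℂ] H x) : Obs H Λ :=
  ⟨siteOp H Λ x a, StarSubalgebra.le_topologicalClosure _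
    (StarAlgebra.subset_adjoin ℂ _ (Set.mem_iUnion.mpr ⟨x, a, rfl⟩))⟩

theorem embed_siteObs {X Λ : Finset Γ} (h : X ⊆ Λ) (x : X) (a : H x →L[ℂ] H x) :
    embed H h (siteObs X x a) = siteObs Λ ⟨x, h x.2⟩ a :=
  Subtype.ext (amp_siteOp H h x a)

/-- A star subalgebra that contains all one-site operators is dense. -/
theorem mem_closure_of_siteObs_mem {Λ : Finset Γ} {C : StarSubalgebra ℂ (Obs H Λ)}
    (h : ∀ x a, siteObs Λ x a ∈ C) (T : Obs H Λ) : T ∈ closure (C : Set (Obs H Λ)) := by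
  have hle : Obs H Λ ≤ (C.map (Obs H Λ).subtype).topologicalClosure := by
    refine StarSubalgebra.topologicalClosure_mono ?_
    rw [StarAlgebra.adjoin_le_iff]
    rintro _ ⟨_, ⟨x, rfl⟩, a, rfl⟩
    exact ⟨siteObs Λ x a, h x a, rfl⟩
  rw [closure_subtype]
  exact hle T.2

theorem norm_amp_le {I J K : Type*} (e : I ≃ J × K) (T : L2 J →L[ℂ] L2 J) : ‖amp e T‖ ≤ ‖T‖ :=
  LinearMap.mkContinuous_norm_le _ (norm_nonneg T) (norm_ampFun_le e T)

theorem embed_norm_le {X Λ : Finset Γ} (h : X ⊆ Λ) (a : Obs H X) : ‖embed H h a‖ ≤ ‖a‖ :=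
  norm_amp_le (splitConf H h) _

theorem embed_continuous {X Λ : Finset Γ} (h : X ⊆ Λ) : Continuous (embed H h) :=
  AddMonoidHomClass.continuous_of_bound (embed H h) 1 fun a => by
    rw [one_mul]
    exact embed_norm_le h a

theorem amp_amp {I J J' K K' : Type*} (e : I ≃ J × K) (e' : J ≃ J' × K')
    (T : L2 J' →L[ℂ] L2 J') :
    amp e (amp e' T) =
      amp ((e.trans (e'.prodCongr (Equiv.refl K))).trans (Equiv.prodAssoc J' K' K)) T := rfl

theorem embed_embed {X Z Λ : Finset Γ} (h : X ⊆ Z) (h' : Z ⊆ Λ) (a : Obs H X) :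
    embed H h' (embed H h a) = embed H (h.trans h') a := by
  refine Subtype.ext ?_
  rw [coe_embed, coe_embed, coe_embed, amp_amp]
  have key : amp (((splitConf H h').trans ((splitConf H h).prodCongr (Equiv.refl (Conf H (Λ \ Z))))).trans
      (Equiv.prodAssoc (Conf H X) (Conf H (Z \ X)) (Conf H (Λ \ Z)))) =
      amp (splitConf H (h.trans h')) := by
    refine amp_congr (fun i => rfl) ?_
    intro i j
    funext x
    by_cases hx : (x : Γ) ∈ X
    · have hz := h hx
      simp [splitConf, hx, hz]
    · by_cases hz : (x : Γ) ∈ Z <;> simp [splitConf, hx, hz]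
  rw [key]

theorem amp_splitConf_sdiff {X Λ : Finset Γ} (h : X ⊆ Λ) :
    amp (splitConf H (Finset.sdiff_subset : Λ \ X ⊆ Λ)) =
      amp ((splitConf H h).trans (Equiv.prodComm _ _)) := by
  refine amp_congr (fun i => rfl) fun i j => ?_
  funext x
  by_cases hx : (x : Γ) ∈ X <;> simp [splitConf, hx]

variable (H) in
/-- The identification of `Obs H (Λ \ X)` with a subalgebra of `Obs H Λ`. -/
abbrev embedCompl (X Λ : Finset Γ) : Obs H (Λ \ X) →⋆ₐ[ℂ] Obs H Λ := embed H Finset.sdiff_subset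

theorem commute_embed_sdiff {X Λ : Finset Γ} (h : X ⊆ Λ) (a : Obs H X) (b : Obs H (Λ \ X)) :
    Commute (embed H h a) (embedCompl H X Λ b) := by
  refine Subtype.ext ?_
  have := amp_commute_swap (splitConf H h) (a : Space H X →L[ℂ] Space H X) b
  rw [← amp_splitConf_sdiff] at this
  exact this

theorem commute_embed {X Z Λ : Finset Γ} (h : X ⊆ Λ) (h' : Z ⊆ Λ) (hd : Disjoint X Z)
    (a : Obs H X) (b : Obs H Z) : Commute (embed H h a) (embed H h' b) := by
  have hZ : Z ⊆ Λ \ X := Finset.subset_sdiff.mpr ⟨h', hd.symm⟩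
  rw [← embed_embed hZ Finset.sdiff_subset b]
  exact commute_embed_sdiff h a _

/-- The finite sums of products `a ⊗ b` with `a ∈ Obs H X` and `b ∈ Obs H (Λ \ X)`. -/
def productSums (H : Γ → Type*) [∀ x, NormedAddCommGroup (H x)]
    [∀ x, InnerProductSpace ℂ (H x)] [∀ x, CompleteSpace (H x)] {X Λ : Finset Γ} (h : X ⊆ Λ) : AddSubmonoid (Obs H Λ) :=
  AddSubmonoid.closure {T | ∃ (a : Obs H X) (b : Obs H (Λ \ X)),
    T = embed H h a * embedCompl H X Λ b}

theorem mul_mem_productSums (H : Γ → Type*) [∀ x, NormedAddCommGroup (H x)]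
    [∀ x, InnerProductSpace ℂ (H x)] [∀ x, CompleteSpace (H x)] {X Λ : Finset Γ} (h : X ⊆ Λ) (a : Obs H X) (b : Obs H (Λ \ X)) :
    embed H h a * embedCompl H X Λ b ∈ productSums H h :=
  AddSubmonoid.subset_closure ⟨a, b, rfl⟩

theorem embed_mul_embed_mul {X Λ : Finset Γ} (h : X ⊆ Λ) (a a' : Obs H X) (b b' : Obs H (Λ \ X)) :
    embed H h a * embedCompl H X Λ b *
      (embed H h a' * embedCompl H X Λ b') =
    embed H h (a * a') * embedCompl H X Λ (b * b') := by
  rw [map_mul, map_mul, mul_assoc, ← mul_assoc (embedCompl H X Λ b),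
    ← (commute_embed_sdiff h a' b).eq]
  simp only [mul_assoc]

theorem star_embed_mul_embed {X Λ : Finset Γ} (h : X ⊆ Λ) (a : Obs H X) (b : Obs H (Λ \ X)) :
    star (embed H h a * embedCompl H X Λ b) =
    embed H h (star a) * embedCompl H X Λ (star b) := by
  rw [star_mul, map_star, map_star, ← map_star, ← map_star, (commute_embed_sdiff h _ _).eq]

/-- The sums of products as a star subalgebra. -/
def productAlg {X Λ : Finset Γ} (h : X ⊆ Λ) : StarSubalgebra ℂ (Obs H Λ) where
  carrier := (productSums H h : Set (Obs H Λ))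
  add_mem' := (productSums H h).add_mem
  zero_mem' := (productSums H h).zero_mem
  one_mem' := by
    have := mul_mem_productSums (H := H) h 1 1
    rwa [map_one, map_one, mul_one] at this
  mul_mem' {S T} hS hT := by
    refine AddSubmonoid.closure_induction₂ (motive := fun S T _ _ => S * T ∈ productSums H h)
      ?_ ?_ ?_ ?_ ?_ hS hT
    · rintro _ _ ⟨a, b, rfl⟩ ⟨a', b', rfl⟩
      rw [embed_mul_embed_mul]
      exact mul_mem_productSums H h _ _
    · intro T _
      rw [zero_mul]
      exact zero_mem _
    · intro T _
      rw [mul_zero]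
      exact zero_mem _
    · intro S S' T _ _ _ h1 h2
      rw [add_mul]
      exact add_mem h1 h2
    · intro S S' T _ _ _ h1 h2
      rw [mul_add]
      exact add_mem h1 h2
  algebraMap_mem' c := by
    have := mul_mem_productSums (H := H) h (algebraMap ℂ _ c) 1
    rwa [map_one, mul_one, AlgHomClass.commutes] at this
  star_mem' {T} hT := by
    refine AddSubmonoid.closure_induction (motive := fun T _ => star T ∈ productSums H h)
      ?_ ?_ ?_ hT
    · rintro _ ⟨a, b, rfl⟩
      rw [star_embed_mul_embed]
      exact mul_mem_productSums H h _ _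
    · rw [star_zero]
      exact zero_mem _
    · intro S T _ _ h1 h2
      rw [star_add]
      exact add_mem h1 h2

/-- The sums of products form a star algebra, and every site lies in `X` or in `Λ \ X`, so this
algebra contains all one-site operators. -/
theorem dense_productSums (H : Γ → Type*) [∀ x, NormedAddCommGroup (H x)]
    [∀ x, InnerProductSpace ℂ (H x)] [∀ x, CompleteSpace (H x)] {X Λ : Finset Γ} (h : X ⊆ Λ) :
    Dense (productSums H h : Set (Obs H Λ)) := by
  intro T
  refine mem_closure_of_siteObs_mem (C := productAlg h) (fun x a => ?_) T
  change _ ∈ productSums H h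
  by_cases hx : (x : Γ) ∈ X
  · have := mul_mem_productSums H h (siteObs X ⟨x, hx⟩ a) 1
    rwa [map_one, mul_one, embed_siteObs] at this
  · have := mul_mem_productSums H h 1
      (siteObs (Λ \ X) ⟨x, Finset.mem_sdiff.mpr ⟨x.2, hx⟩⟩ a)
    rwa [map_one, one_mul, embed_siteObs] at this

theorem productSums_induction {X Λ : Finset Γ} (h : X ⊆ Λ) {p : Obs H Λ → Prop}
    (add : ∀ S T, p S → p T → p (S + T))
    (mul : ∀ a b, p (embed H h a * embedCompl H X Λ b)) {T : Obs H Λ}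
    (hT : T ∈ productSums H h) : p T := by
  refine AddSubmonoid.closure_induction (motive := fun T _ => p T) ?_ ?_ ?_ hT
  · rintro _ ⟨a, b, rfl⟩
    exact mul a b
  · have := mul 0 0
    rwa [map_zero, zero_mul] at this
  · exact fun S T _ _ => add S T

theorem obs_induction {X Λ : Finset Γ} (h : X ⊆ Λ) {p : Obs H Λ → Prop}
    (closed : IsClosed {T | p T}) (add : ∀ S T, p S → p T → p (S + T))
    (mul : ∀ a b, p (embed H h a * embedCompl H X Λ b)) (T : Obs H Λ) : p T := by
  have : closure (productSums H h : Set (Obs H Λ)) ⊆ {T | p T} :=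
    closure_minimal (fun T (hT : T ∈ productSums H h) => productSums_induction h add mul hT) closed
  exact this (dense_productSums H h T)

theorem coeff_embed_mul {X Λ : Finset Γ} (h : X ⊆ Λ) (b : Obs H (Λ \ X))
    (k l : Conf H (Λ \ X)) :
    ∃ c : ℂ, ∀ a : Obs H X, coeff (splitConf H h) k l
      (embed H h a * embedCompl H X Λ b : Obs H Λ) = (c • a : Obs H X) := by
  obtain ⟨c, hc⟩ := coeff_amp_swap (splitConf H h) (b : Space H (Λ \ X) →L[ℂ] Space H (Λ \ X)) k l
  refine ⟨c, fun a => ?_⟩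
  rw [MulMemClass.coe_mul, coe_embed, coe_embed, coeff_amp_mul, amp_splitConf_sdiff h,
    hc, mul_smul_comm, mul_one]
  rfl

/-- True for `a ⊗ b`, whose coefficients are multiples of `a`; it extends by density because `Obs H
X` is closed. -/
theorem coeff_mem_obs {X Λ : Finset Γ} (h : X ⊆ Λ) (k l : Conf H (Λ \ X)) (T : Obs H Λ) :
    coeff (splitConf H h) k l T ∈ Obs H X := by
  have hcl : IsClosed (Obs H X : Set (Space H X →L[ℂ] Space H X)) := inferInstance
  refine obs_induction h (p := fun T => coeff (splitConf H h) k l T ∈ Obs H X)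
    ?_ ?_ ?_ T
  · have hc : Continuous fun T : Obs H Λ => coeff (splitConf H h) k l (T : Space H Λ →L[ℂ] Space H Λ) :=
      (coeff (splitConf H h) k l).continuous.comp continuous_subtype_val
    exact hcl.preimage hc
  · intro S T hS hT
    have : coeff (splitConf H h) k l (S + T : Obs H Λ) =
        coeff (splitConf H h) k l S + coeff (splitConf H h) k l T :=
      map_add (coeff (splitConf H h) k l) S.1 T.1
    rw [this]
    exact add_mem hS hT
  · intro a b
    obtain ⟨c, hc⟩ := coeff_embed_mul h b k l
    rw [hc]
    exact Subtype.coe_prop _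

/-- The matrix coefficients of an observable over `Λ ⊇ X` are observables over `X`. -/
def obsCoeff {X Λ : Finset Γ} (h : X ⊆ Λ) (k l : Conf H (Λ \ X)) : Obs H Λ →L[ℂ] Obs H X :=
  ((coeff (splitConf H h) k l).comp (Obs H Λ).toSubmodule.subtypeL).codRestrict
    (Obs H X).toSubmodule fun T => coeff_mem_obs h k l T

end Lattice

/-! ### Construction and properties of `K ⊗ id`. -/

/-- A closed densely defined bounded linear relation is the graph of a bounded operator. -/
theorem exists_clm_of_graph {E F : Type*} [NormedAddCommGroup E] [NormedSpace ℂ E]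
    [CompleteSpace E] [NormedAddCommGroup F] [NormedSpace ℂ F] [CompleteSpace F]
    (G : Submodule ℂ (E × F)) (hG : IsClosed (G : Set (E × F))) (c : ℝ)
    (hb : ∀ p ∈ G, ‖p.2‖ ≤ c * ‖p.1‖) (hd : Dense (Prod.fst '' (G : Set (E × F)))) :
    ∃ f : E →L[ℂ] F, ∀ x, (x, f x) ∈ G := by
  have : CompleteSpace G := hG.completeSpace_coe
  let φ : G →L[ℂ] E := (ContinuousLinearMap.fst ℂ E F).comp G.subtypeL
  -- The first projection is bounded below on the graph, hence has closed range; the range is also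
  -- dense. The `1` accounts for the first component in the maximum norm of the product.
  have hφ : ∀ p : G, ‖p‖ ≤ (max 1 c).toNNReal * ‖φ p‖ := by
    intro p
    rw [Real.coe_toNNReal _ (zero_le_one.trans (le_max_left 1 c))]
    refine max_le ?_ ((hb p p.2).trans ?_)
    · exact le_mul_of_one_le_left (norm_nonneg _) (le_max_left 1 c)
    · exact mul_le_mul_of_nonneg_right (le_max_right 1 c) (norm_nonneg _)
  have hanti : AntilipschitzWith (max 1 c).toNNReal φ := AddMonoidHomClass.antilipschitz_of_bound φ hφ
  have hsurj : Function.Surjective φ := by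
    have h1 : IsClosed (Set.range φ) := hanti.isClosed_range φ.uniformContinuous
    rw [← Set.range_eq_univ, ← h1.closure_eq, ← dense_iff_closure_eq]
    refine hd.mono ?_
    rintro _ ⟨p, hp, rfl⟩
    exact ⟨⟨p, hp⟩, rfl⟩
  let e : G ≃ₗ[ℂ] E := LinearEquiv.ofBijective φ.toLinearMap ⟨hanti.injective, hsurj⟩
  have he : ∀ x, (e.symm x : E × F).1 = x := fun x => e.apply_symm_apply x
  refine ⟨LinearMap.mkContinuous (LinearMap.snd ℂ E F ∘ₗ G.subtype ∘ₗ e.symm.toLinearMap) c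
    fun x => ?_, fun x => ?_⟩
  · have := hb _ (e.symm x).2
    rwa [he] at this
  · have h2 : (x, (e.symm x : E × F).2) = (e.symm x : E × F) := Prod.ext (he x).symm rfl
    exact h2 ▸ (e.symm x).2

/-- A map between coefficients that is bounded on the vectors they determine lifts to a bounded
operator, provided that it lifts on a dense additive submonoid. -/
theorem exists_clm_of_coeff {E A ι : Type*} [NormedAddCommGroup E] [NormedSpace ℂ E]
    [CompleteSpace E] [NormedAddCommGroup A] [NormedSpace ℂ A] (q : ι → E →L[ℂ] A) (K : A →L[ℂ] A)
    (c : ℝ) (hb : ∀ x y, (∀ i, q i y = K (q i x)) → ‖y‖ ≤ c * ‖x‖) (D : Set E)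
    (hD : Dense (AddSubmonoid.closure D : Set E)) (hlift : ∀ x ∈ D, ∃ y, ∀ i, q i y = K (q i x)) :
    ∃ f : E →L[ℂ] E, ∀ x i, q i (f x) = K (q i x) := by
  let G : Submodule ℂ (E × E) :=
    { carrier := {p | ∀ i, q i p.2 = K (q i p.1)}
      add_mem' := fun {p r} hp hr i => by
        simp only [Prod.fst_add, Prod.snd_add, map_add, hp i, hr i]
      zero_mem' := fun i => by simp only [Prod.fst_zero, Prod.snd_zero, map_zero]
      smul_mem' := fun c p hp i => by
        simp only [Prod.smul_fst, Prod.smul_snd, map_smul, hp i] }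
  refine exists_clm_of_graph G ?_ c (fun p hp => hb p.1 p.2 hp) ?_
  · have : (G : Set (E × E)) = ⋂ i, {p | q i p.2 = K (q i p.1)} := by
      ext p
      simp only [Set.mem_iInter]
      rfl
    rw [this]
    exact isClosed_iInter fun i => isClosed_eq (by fun_prop) (by fun_prop)
  · refine hD.mono fun x hx => ?_
    refine AddSubmonoid.closure_induction
      (motive := fun x _ => x ∈ Prod.fst '' (G : Set (E × E))) ?_ ?_ ?_ hx
    · intro x hx
      obtain ⟨y, hy⟩ := hlift x hx
      exact ⟨(x, y), hy, rfl⟩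
    · exact ⟨0, zero_mem G, rfl⟩
    · rintro _ _ _ _ ⟨p, hp, rfl⟩ ⟨r, hr, rfl⟩
      exact ⟨p + r, add_mem hp hr, rfl⟩

section Lattice

variable {Γ : Type*} [DecidableEq Γ] {H : Γ → Type*} [∀ x, NormedAddCommGroup (H x)]
  [∀ x, InnerProductSpace ℂ (H x)] [∀ x, CompleteSpace (H x)] {X Z Λ : Finset Γ}

theorem embed_mul (h : X ⊆ Λ) (a b : Obs H X) :
    embed H h (a * b) = embed H h a * embed H h b := map_mul _ a b

theorem embed_mul_embed {W : Finset Γ} (hX : X ⊆ W) (hZ : Z ⊆ W) (hW : W ⊆ Λ) (a : Obs H X)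
    (b : Obs H Z) : embed H hW (embed H hX a * embed H hZ b) =
      embed H (hX.trans hW) a * embed H (hZ.trans hW) b :=
  (embed_mul hW _ _).trans (congrArg₂ (· * ·) (embed_embed hX hW a) (embed_embed hZ hW b))

theorem obsCoeff_ext (h : X ⊆ Λ) {S T : Obs H Λ}
    (hST : ∀ k l, obsCoeff h k l S = obsCoeff h k l T) : S = T :=
  Subtype.ext (coeff_ext (splitConf H h) fun k l => congrArg Subtype.val (hST k l))

theorem obsCoeff_mul (h : X ⊆ Λ) (b : Obs H (Λ \ X)) (k l : Conf H (Λ \ X)) :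
    ∃ c : ℂ, ∀ a : Obs H X, obsCoeff h k l (embed H h a * embedCompl H X Λ b) = c • a :=
  (coeff_embed_mul h b k l).imp fun _ hc a => Subtype.ext (hc a)

theorem norm_le_of_obsCoeff (h : X ⊆ Λ) (K : Obs H X →L[ℂ] Obs H X) (hK : cbNorm K < ∞)
    {T T' : Obs H Λ} (hT : ∀ k l, obsCoeff h k l T' = K (obsCoeff h k l T)) :
    ‖T'‖ ≤ (cbNorm K).toReal * ‖T‖ :=
  norm_le_cbNorm_mul (splitConf H h) K hK T T' (fun k l => obsCoeff h k l T)
    (fun _ _ => rfl) fun k l => congrArg Subtype.val (hT k l)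

/-- Applying `K` to every matrix coefficient defines a closed relation. The cb-norm bounds it, and
on products it is solved by `K a ⊗ b`. -/
theorem exists_amplify (h : X ⊆ Λ) (K : Obs H X →L[ℂ] Obs H X) (hK : cbNorm K < ∞) :
    ∃ K' : Obs H Λ →L[ℂ] Obs H Λ, ∀ T k l, obsCoeff h k l (K' T) = K (obsCoeff h k l T) := by
  obtain ⟨f, hf⟩ := exists_clm_of_coeff (E := Obs H Λ) (A := Obs H X)
    (fun p : Conf H (Λ \ X) × Conf H (Λ \ X) => obsCoeff h p.1 p.2) K (cbNorm K).toReal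
    (fun T T' hT => norm_le_of_obsCoeff h K hK fun k l => hT (k, l)) _
    (dense_productSums (H := H) h) (by
      rintro _ ⟨a, b, rfl⟩
      refine ⟨embed H h (K a) * embedCompl H X Λ b, fun p => ?_⟩
      obtain ⟨c, hc⟩ := obsCoeff_mul h b p.1 p.2
      exact (hc (K a)).trans ((map_smul K c a).symm.trans (congrArg K (hc a).symm)))
  exact ⟨f, fun T k l => hf T (k, l)⟩

/-- The defining property of `K ⊗ id`, for completely bounded `K`. -/
theorem amplify_mul (h : X ⊆ Λ) {K : Obs H X →L[ℂ] Obs H X} (hK : cbNorm K < ∞)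
    (a : Obs H X) (b : Obs H (Λ \ X)) :
    amplify h K (embed H h a * embedCompl H X Λ b) = embed H h (K a) * embedCompl H X Λ b := by
  have hex : ∃ K' : Obs H Λ →L[ℂ] Obs H Λ, ∀ (a : Obs H X) (b : Obs H (Λ \ X)),
      K' (embed H h a * embed H Finset.sdiff_subset b) =
        embed H h (K a) * embed H Finset.sdiff_subset b := by
    obtain ⟨K', hK'⟩ := exists_amplify h K hK
    refine ⟨K', fun a b => obsCoeff_ext h fun k l => ?_⟩
    obtain ⟨c, hc⟩ := obsCoeff_mul h b k l
    exact (hK' _ k l).trans ((congrArg K (hc a)).trans ((map_smul K c a).trans (hc (K a)).symm))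
  have hdef : amplify h K = hex.choose := dif_pos hex
  rw [hdef]
  exact hex.choose_spec a b

theorem obsCoeff_amplify (h : X ⊆ Λ) {K : Obs H X →L[ℂ] Obs H X} (hK : cbNorm K < ∞)
    (T : Obs H Λ) (k l : Conf H (Λ \ X)) :
    obsCoeff h k l (amplify h K T) = K (obsCoeff h k l T) := by
  refine obs_induction h (p := fun T => obsCoeff h k l (amplify h K T) = K (obsCoeff h k l T))
    ?_ ?_ ?_ T
  · exact isClosed_eq ((obsCoeff h k l).continuous.comp (amplify h K).continuous)
      (K.continuous.comp (obsCoeff h k l).continuous)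
  · intro S T hS hT
    simp only [map_add, hS, hT]
  · intro a b
    obtain ⟨c, hc⟩ := obsCoeff_mul h b k l
    exact (congrArg (obsCoeff h k l) (amplify_mul h hK a b)).trans
      ((hc (K a)).trans ((map_smul K c a).symm.trans (congrArg K (hc a).symm)))

theorem norm_amplify_le (h : X ⊆ Λ) {K : Obs H X →L[ℂ] Obs H X} (hK : cbNorm K < ∞)
    (T : Obs H Λ) : ‖amplify h K T‖ ≤ (cbNorm K).toReal * ‖T‖ :=
  norm_le_of_obsCoeff h K hK (obsCoeff_amplify h hK T)

theorem amplify_mul_of_disjoint (h : X ⊆ Λ) (h' : Z ⊆ Λ) (hd : Disjoint X Z)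
    {K : Obs H X →L[ℂ] Obs H X} (hK : cbNorm K < ∞) (a : Obs H X) (b : Obs H Z) :
    amplify h K (embed H h a * embed H h' b) = embed H h (K a) * embed H h' b := by
  have hZ : Z ⊆ Λ \ X := Finset.subset_sdiff.mpr ⟨h', hd.symm⟩
  rw [← embed_embed hZ Finset.sdiff_subset b]
  exact amplify_mul h hK a _

/-- Over `X` the observable is `1`, which `K` kills; this produces `δ_Y(X)` in the final bound. -/
theorem amplify_embed_of_disjoint (h : X ⊆ Λ) (h' : Z ⊆ Λ) (hd : Disjoint X Z)
    {K : Obs H X →L[ℂ] Obs H X} (hK : cbNorm K < ∞) (hK1 : K 1 = 0) (b : Obs H Z) :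
    amplify h K (embed H h' b) = 0 := by
  have := amplify_mul_of_disjoint h h' hd hK 1 b
  rwa [hK1, map_zero, zero_mul, map_one, one_mul] at this

/-- Amplifications of maps on disjoint regions commute. -/
theorem amplify_comm (h : X ⊆ Λ) (h' : Z ⊆ Λ) (hd : Disjoint X Z)
    {K : Obs H X →L[ℂ] Obs H X} (hK : cbNorm K < ∞) {K' : Obs H Z →L[ℂ] Obs H Z}
    (hK' : cbNorm K' < ∞) (T : Obs H Λ) :
    amplify h K (amplify h' K' T) = amplify h' K' (amplify h K T) := by
  have hZ : Z ⊆ Λ \ X := Finset.subset_sdiff.mpr ⟨h', hd.symm⟩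
  refine obs_induction h (p := fun T => amplify h K (amplify h' K' T) =
    amplify h' K' (amplify h K T)) ?_ ?_ ?_ T
  · exact isClosed_eq ((amplify h K).continuous.comp (amplify h' K').continuous)
      ((amplify h' K').continuous.comp (amplify h K).continuous)
  · intro S T hS hT
    simp only [map_add, hS, hT]
  intro a b
  have hcont : Continuous fun b => embed H h a * embedCompl H X Λ b :=
    continuous_const.mul (embed_continuous _)
  have hcont' : Continuous fun b => embed H h (K a) * embedCompl H X Λ b :=
    continuous_const.mul (embed_continuous _)
  rw [amplify_mul h hK]
  -- A second density argument, now inside `Λ \ X`, reduces to products over the three regions `X`,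
  -- `Z` and the rest.
  refine obs_induction hZ (p := fun b => amplify h K (amplify h' K' (embed H h a * embedCompl H X Λ b)) =
    amplify h' K' (embed H h (K a) * embedCompl H X Λ b)) ?_ ?_ ?_ b
  · exact isClosed_eq ((amplify h K).continuous.comp ((amplify h' K').continuous.comp hcont))
      ((amplify h' K').continuous.comp hcont')
  · intro S T hS hT
    simp only [map_add, mul_add, hS, hT]
  intro c d
  -- move the factor over `Z` to the left and read the rest as an observable over `Λ \ Z`
  have hX : X ⊆ Λ \ Z := Finset.subset_sdiff.mpr ⟨h, hd⟩
  have hR : (Λ \ X) \ Z ⊆ Λ \ Z := Finset.sdiff_subset_sdiff Finset.sdiff_subset le_rfl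
  have hR' : (Λ \ X) \ Z ⊆ Λ \ X := Finset.sdiff_subset
  have key : ∀ (a : Obs H X) (c : Obs H Z), embed H h a * embedCompl H X Λ
      (embed H hZ c * embedCompl H Z (Λ \ X) d) =
      embed H h' c * embedCompl H Z Λ (embed H hX a * embed H hR d) := by
    intro a c
    calc embed H h a * embedCompl H X Λ (embed H hZ c * embedCompl H Z (Λ \ X) d)
        = embed H h a * (embed H h' c * embed H (hR'.trans Finset.sdiff_subset) d) :=
          congrArg (embed H h a * ·) (embed_mul_embed hZ hR' Finset.sdiff_subset c d)
      _ = embed H h' c * (embed H h a * embed H (hR.trans Finset.sdiff_subset) d) :=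
          (commute_embed h h' hd a c).left_comm _
      _ = embed H h' c * embedCompl H Z Λ (embed H hX a * embed H hR d) :=
          congrArg (embed H h' c * ·) (embed_mul_embed hX hR Finset.sdiff_subset a d).symm
  have key' : ∀ a : Obs H X, amplify h' K' (embed H h a * embedCompl H X Λ
      (embed H hZ c * embedCompl H Z (Λ \ X) d)) =
      embed H h a * embedCompl H X Λ (embed H hZ (K' c) * embedCompl H Z (Λ \ X) d) := fun a =>
    (congrArg (amplify h' K') (key a c)).trans
      ((amplify_mul h' hK' c _).trans (key a (K' c)).symm)
  exact (congrArg (amplify h K) (key' a)).trans ((amplify_mul h hK a _).trans (key' (K a)).symm)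

end Lattice

/-! ### Algebra of the Lindblad expression. -/

section Algebra

variable {A : Type*} [CStarAlgebra A]

theorem lindblad_zero (Φ : A) (V : ℕ → A) (a : A) :
    lindblad Φ V 0 a = Complex.I • (Φ * a - a * Φ) := by
  rw [lindblad, Finset.range_zero, Finset.sum_empty, add_zero]

theorem lindblad_succ (Φ : A) (V : ℕ → A) (n : ℕ) (a : A) :
    lindblad Φ V (n + 1) a = lindblad Φ V n a + (star (V n) * a * V n -
      (1 / 2 : ℂ) • (star (V n) * V n * a + a * (star (V n) * V n))) := by
  rw [lindblad, lindblad, Finset.sum_range_succ, add_assoc]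

theorem lindblad_add (Φ : A) (V : ℕ → A) (n : ℕ) (a b : A) :
    lindblad Φ V n (a + b) = lindblad Φ V n a + lindblad Φ V n b := by
  induction n with
  | zero =>
    simp only [lindblad_zero, mul_add, add_mul]
    module
  | succ n ih =>
    simp only [lindblad_succ, ih, mul_add, add_mul]
    module

theorem lindblad_one (Φ : A) (V : ℕ → A) (n : ℕ) : lindblad Φ V n 1 = 0 := by
  induction n with
  | zero => rw [lindblad_zero, mul_one, one_mul, sub_self, smul_zero]
  | succ n ih =>
    rw [lindblad_succ, ih, mul_one, mul_one, one_mul]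
    module

/-- This identifies the embedded Lindblad expression with `Ψ ⊗ id` on products, before any limit
over the Lindblad operators. -/
theorem lindblad_mul_of_commute {Φ : A} {V : ℕ → A} {b : A} (hΦ : Commute Φ b)
    (hV : ∀ m, Commute (V m) b) (hV' : ∀ m, Commute (star (V m)) b) (n : ℕ) (a : A) :
    lindblad Φ V n (a * b) = lindblad Φ V n a * b := by
  induction n with
  | zero => simp only [lindblad_zero, smul_mul_assoc, sub_mul, mul_assoc, hΦ.eq]
  | succ n ih =>
    simp only [lindblad_succ, ih, add_mul, smul_mul_assoc, sub_mul, mul_assoc, (hV n).eq,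
      (hV' n).left_comm]

theorem map_lindblad {B : Type*} [CStarAlgebra B] (φ : A →⋆ₐ[ℂ] B) (Φ : A) (V : ℕ → A) (n : ℕ)
    (a : A) : φ (lindblad Φ V n a) = lindblad (φ Φ) (fun m => φ (V m)) n (φ a) := by
  simp only [lindblad, map_add, map_sum, map_sub, map_mul, map_smul, map_star]

/-- The dissipation of a Lindblad generator is a sum of squares. -/
theorem lindblad_dissipation {Φ : A} (hΦ : star Φ = Φ) (V : ℕ → A) (n : ℕ) (a : A) :
    lindblad Φ V n (star a * a) - star (lindblad Φ V n a) * a - star a * lindblad Φ V n a =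
      ∑ m ∈ Finset.range n, star (V m * a - a * V m) * (V m * a - a * V m) := by
  have hI : star Complex.I = - Complex.I := Complex.conj_I
  have hh : star (1 / 2 : ℂ) = 1 / 2 := by simp
  induction n with
  | zero =>
    simp only [lindblad_zero, Finset.range_zero, Finset.sum_empty, star_smul, star_sub,
      star_mul, hΦ, hI, smul_mul_assoc, mul_smul_comm, mul_sub, sub_mul, mul_assoc, smul_sub]
    module
  | succ n ih =>
    rw [Finset.sum_range_succ, ← ih]
    simp only [lindblad_succ, star_add, star_sub, star_smul, hh, star_mul, star_star, mul_sub,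
      sub_mul, mul_add, add_mul, smul_add, smul_mul_assoc, mul_smul_comm, mul_assoc]
    module

end Algebra

/-! ### Dissipative maps and near-contractivity. -/

section Dissipative

variable {E : Type*} [NormedAddCommGroup E] [InnerProductSpace ℂ E] [CompleteSpace E]
  {A : StarSubalgebra ℂ (E →L[ℂ] E)}

/-- The dissipation inequality `Ψ(a* a) ≥ Ψ(a)* a + a* Ψ(a)`, in the sense of quadratic forms. -/
def IsDissipative (Ψ : A →L[ℂ] A) : Prop :=
  ∀ (a : A) (ξ : E), 2 * (⟪(a : E →L[ℂ] E) ξ, (Ψ a : E →L[ℂ] E) ξ⟫_ℂ).re ≤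
    (⟪ξ, (Ψ (star a * a) : E →L[ℂ] E) ξ⟫_ℂ).re

theorem isDissipative_zero : IsDissipative (0 : A →L[ℂ] A) := fun a ξ => by simp

theorem IsDissipative.add {Ψ Ψ' : A →L[ℂ] A} (h : IsDissipative Ψ) (h' : IsDissipative Ψ') :
    IsDissipative (Ψ + Ψ') := fun a ξ => by
  have := add_le_add (h a ξ) (h' a ξ)
  simpa [inner_add_right, mul_add] using this

theorem isDissipative_sum {ι : Type*} (s : Finset ι) {Ψ : ι → A →L[ℂ] A}
    (h : ∀ i ∈ s, IsDissipative (Ψ i)) : IsDissipative (∑ i ∈ s, Ψ i) :=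
  Finset.sum_induction Ψ IsDissipative (fun _ _ => IsDissipative.add) isDissipative_zero h

/-- `1 + ε Ψ` is a contraction up to an error of second order, for dissipative `Ψ`. -/
theorem IsDissipative.norm_add_smul_le {Ψ : A →L[ℂ] A} (h : IsDissipative Ψ) {ε : ℝ} (hε : 0 ≤ ε)
    (a : A) : ‖a + (ε : ℂ) • Ψ a‖ ≤ (1 + (ε * ‖Ψ‖) ^ 2) * ‖a‖ := by
  set R : A →L[ℂ] A := 1 + (ε : ℂ) • Ψ with hR
  have hRa : ∀ b, R b = b + (ε : ℂ) • Ψ b := fun b => rfl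
  set c : ℝ := (ε * ‖Ψ‖) ^ 2 with hc
  have hc0 : 0 ≤ c := sq_nonneg _
  -- Dissipativity gives `‖R(b) ξ‖² ≤ Re ⟪ξ, R(b* b) ξ⟫ + ε² ‖Ψ(b) ξ‖²`: the first-order terms are
  -- absorbed into `R(b* b)`. Bounding `R(b* b)` by `‖R‖ ‖b‖²` yields the self-consistent inequality
  -- `‖R‖² ≤ ‖R‖ + c`.
  have key : ∀ b : A, ‖R b‖ ≤ √(‖R‖ + c) * ‖b‖ := by
    intro b
    refine ContinuousLinearMap.opNorm_le_bound _ (by positivity) fun ξ => ?_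
    refine le_of_sq_le_sq ?_ (by positivity)
    have hΨb : ‖(Ψ b : E →L[ℂ] E) ξ‖ ≤ ‖Ψ‖ * ‖b‖ * ‖ξ‖ :=
      (ContinuousLinearMap.le_of_opNorm_le _ (Ψ.le_opNorm b) ξ)
    have h1 : (R b : E →L[ℂ] E) ξ = (b : E →L[ℂ] E) ξ + (ε : ℂ) • (Ψ b : E →L[ℂ] E) ξ := rfl
    have h2 : (R (star b * b) : E →L[ℂ] E) ξ =
        (ContinuousLinearMap.adjoint (b : E →L[ℂ] E)) ((b : E →L[ℂ] E) ξ) +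
          (ε : ℂ) • (Ψ (star b * b) : E →L[ℂ] E) ξ := rfl
    have h3 : (⟪ξ, (R (star b * b) : E →L[ℂ] E) ξ⟫_ℂ).re =
        ‖(b : E →L[ℂ] E) ξ‖ ^ 2 + ε * (⟪ξ, (Ψ (star b * b) : E →L[ℂ] E) ξ⟫_ℂ).re := by
      rw [h2, inner_add_right, ContinuousLinearMap.adjoint_inner_right, inner_smul_right,
        Complex.add_re, Complex.re_ofReal_mul]
      congr 1
      exact inner_self_eq_norm_sq (𝕜 := ℂ) _
    have h4 : (⟪ξ, (R (star b * b) : E →L[ℂ] E) ξ⟫_ℂ).re ≤ ‖R‖ * ‖b‖ ^ 2 * ‖ξ‖ ^ 2 := by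
      refine (Complex.re_le_norm _).trans ((norm_inner_le_norm _ _).trans ?_)
      have h5 : ‖(R (star b * b) : E →L[ℂ] E)‖ ≤ ‖R‖ * ‖b‖ ^ 2 := by
        refine (R.le_opNorm _).trans (mul_le_mul_of_nonneg_left ?_ (norm_nonneg _))
        refine (norm_mul_le _ _).trans ?_
        rw [norm_star, sq]
      have := ContinuousLinearMap.le_of_opNorm_le _ h5 ξ
      calc ‖ξ‖ * ‖(R (star b * b) : E →L[ℂ] E) ξ‖ ≤ ‖ξ‖ * (‖R‖ * ‖b‖ ^ 2 * ‖ξ‖) := by gcongr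
        _ = ‖R‖ * ‖b‖ ^ 2 * ‖ξ‖ ^ 2 := by ring
    have h6 : ‖(R b : E →L[ℂ] E) ξ‖ ^ 2 = ‖(b : E →L[ℂ] E) ξ‖ ^ 2 +
        ε * (2 * (⟪(b : E →L[ℂ] E) ξ, (Ψ b : E →L[ℂ] E) ξ⟫_ℂ).re) +
        ε ^ 2 * ‖(Ψ b : E →L[ℂ] E) ξ‖ ^ 2 := by
      rw [h1, norm_add_sq (𝕜 := ℂ), inner_smul_right, norm_smul, Complex.norm_real,
        Real.norm_of_nonneg hε, mul_pow, RCLike.re_eq_complex_re, Complex.re_ofReal_mul]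
      ring
    have h7 := mul_le_mul_of_nonneg_left (h b ξ) hε
    have h8 : ε ^ 2 * ‖(Ψ b : E →L[ℂ] E) ξ‖ ^ 2 ≤ ε ^ 2 * (‖Ψ‖ * ‖b‖ * ‖ξ‖) ^ 2 := by gcongr
    rw [mul_pow, mul_pow, Real.sq_sqrt (by positivity)]
    calc ‖(R b : E →L[ℂ] E) ξ‖ ^ 2 ≤ ‖R‖ * ‖b‖ ^ 2 * ‖ξ‖ ^ 2 + ε ^ 2 * (‖Ψ‖ * ‖b‖ * ‖ξ‖) ^ 2 := by
          linarith
      _ = (‖R‖ + c) * ‖b‖ ^ 2 * ‖ξ‖ ^ 2 := by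
          rw [hc]
          ring
  have hp : ‖R‖ ≤ √(‖R‖ + c) := R.opNorm_le_bound (by positivity) key
  have hp2 : ‖R‖ ^ 2 ≤ ‖R‖ + c := by
    have := pow_le_pow_left₀ (norm_nonneg R) hp 2
    rwa [Real.sq_sqrt (by positivity)] at this
  have hp3 : ‖R‖ ≤ 1 + c := by
    by_contra hlt
    rw [not_le] at hlt
    have h1 : (1 + c) * (‖R‖ - 1) ≤ ‖R‖ * (‖R‖ - 1) :=
      mul_le_mul_of_nonneg_right hlt.le (by linarith)
    have h2 : 1 * c < (1 + c) * (‖R‖ - 1) :=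
      mul_lt_mul' (by linarith) (by linarith) hc0 (by linarith)
    linarith [mul_sub ‖R‖ ‖R‖ 1, sq ‖R‖]
  rw [← hRa]
  exact R.le_of_opNorm_le hp3 a

variable [IsClosed (A : Set (E →L[ℂ] E))]

/-- The quadratic-form version of the sum of squares is stable under strong limits, so it survives
infinitely many Lindblad operators. -/
theorem re_inner_lindblad {Φ : A} (hΦ : star Φ = Φ) (V : ℕ → A) (n : ℕ) (a : A) (ξ : E) :
    2 * (⟪(a : E →L[ℂ] E) ξ, ((lindblad Φ V n a : A) : E →L[ℂ] E) ξ⟫_ℂ).re ≤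
      (⟪ξ, ((lindblad Φ V n (star a * a) : A) : E →L[ℂ] E) ξ⟫_ℂ).re := by
  have hdis := lindblad_dissipation hΦ V n a
  rw [sub_eq_iff_eq_add, sub_eq_iff_eq_add] at hdis
  have hsq : ∀ b c : A, ⟪ξ, ((star b * c : A) : E →L[ℂ] E) ξ⟫_ℂ =
      ⟪(b : E →L[ℂ] E) ξ, (c : E →L[ℂ] E) ξ⟫_ℂ := fun b c =>
    ContinuousLinearMap.adjoint_inner_right (b : E →L[ℂ] E) ξ ((c : E →L[ℂ] E) ξ)
  have hsum : 0 ≤ (⟪ξ, ((∑ m ∈ Finset.range n,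
      star (V m * a - a * V m) * (V m * a - a * V m) : A) : E →L[ℂ] E) ξ⟫_ℂ).re := by
    rw [← StarSubalgebra.coe_subtype, map_sum, sum_apply, inner_sum, Complex.re_sum]
    refine Finset.sum_nonneg fun m _ => ?_
    rw [StarSubalgebra.coe_subtype, hsq]
    exact inner_self_nonneg (𝕜 := ℂ)
  rw [hdis]
  have hadd : ∀ b c : A, (⟪ξ, ((b + c : A) : E →L[ℂ] E) ξ⟫_ℂ).re =
      (⟪ξ, (b : E →L[ℂ] E) ξ⟫_ℂ).re + (⟪ξ, (c : E →L[ℂ] E) ξ⟫_ℂ).re := fun b c => by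
    rw [← Complex.add_re, ← inner_add_right]
    rfl
  rw [hadd, hadd, hsq, hsq]
  have hsymm : (⟪((lindblad Φ V n a : A) : E →L[ℂ] E) ξ, (a : E →L[ℂ] E) ξ⟫_ℂ).re =
      (⟪(a : E →L[ℂ] E) ξ, ((lindblad Φ V n a : A) : E →L[ℂ] E) ξ⟫_ℂ).re := inner_re_symm (𝕜 := ℂ) _ _
  linarith

end Dissipative

/-! ### Dissipativity of the amplified local terms. -/

section Lattice

variable {Γ : Type*} [DecidableEq Γ] {H : Γ → Type*} [∀ x, NormedAddCommGroup (H x)]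
  [∀ x, InnerProductSpace ℂ (H x)] [∀ x, CompleteSpace (H x)] {Z Λ : Finset Γ}

theorem LindbladFamily.map_one (𝓛 : LindbladFamily H) (t : ℝ) (Z : Finset Γ) : 𝓛.Ψ t Z 1 = 0 := by
  refine Subtype.ext (ContinuousLinearMap.ext fun ξ => ?_)
  have := 𝓛.tendsto t Z 1 ξ
  simp only [lindblad_one] at this
  exact tendsto_nhds_unique this tendsto_const_nhds

/-- The partial sums of the local terms converge strongly on sums of products. -/
theorem LindbladFamily.tendsto_amplify (𝓛 : LindbladFamily H) (t : ℝ) (h : Z ⊆ Λ) {T : Obs H Λ}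
    (hT : T ∈ productSums H h) (ξ : Space H Λ) :
    Tendsto (fun n => ((lindblad (embed H h (𝓛.Φ t Z)) (fun m => embed H h (𝓛.V t Z m)) n T :
      Obs H Λ) : Space H Λ →L[ℂ] Space H Λ) ξ) atTop
      (𝓝 ((amplify h (𝓛.Ψ t Z) T : Space H Λ →L[ℂ] Space H Λ) ξ)) := by
  refine productSums_induction h (p := fun T => Tendsto (fun n =>
    ((lindblad (embed H h (𝓛.Φ t Z)) (fun m => embed H h (𝓛.V t Z m)) n T :
      Obs H Λ) : Space H Λ →L[ℂ] Space H Λ) ξ) atTop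
      (𝓝 ((amplify h (𝓛.Ψ t Z) T : Space H Λ →L[ℂ] Space H Λ) ξ))) ?_ ?_ hT
  · intro S T hS hT
    simp only [lindblad_add, _root_.map_add]
    exact hS.add hT
  · intro a b
    rw [amplify_mul h (𝓛.completelyBounded t Z)]
    have hb : ∀ c : Obs H Z, Commute (embed H h c) (embedCompl H Z Λ b) := fun c =>
      commute_embed_sdiff h c b
    have hlin : ∀ n, lindblad (embed H h (𝓛.Φ t Z)) (fun m => embed H h (𝓛.V t Z m)) n
        (embed H h a * embedCompl H Z Λ b) =
        embed H h (lindblad (𝓛.Φ t Z) (𝓛.V t Z) n a) * embedCompl H Z Λ b := fun n => by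
      rw [lindblad_mul_of_commute (hb _) (fun m => hb _) (fun m => ?_), ← map_lindblad]
      rw [← map_star]
      exact hb _
    simp only [hlin]
    exact tendsto_amp (splitConf H h) (𝓛.tendsto t Z a) ((embedCompl H Z Λ b).1 ξ)

/-- The amplified local terms are dissipative. -/
theorem LindbladFamily.isDissipative_amplify (𝓛 : LindbladFamily H) (t : ℝ) (h : Z ⊆ Λ) :
    IsDissipative (amplify h (𝓛.Ψ t Z)) := by
  intro T ξ
  have hcl : IsClosed {T : Obs H Λ | 2 * (⟪(T : Space H Λ →L[ℂ] Space H Λ) ξ,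
      (amplify h (𝓛.Ψ t Z) T : Space H Λ →L[ℂ] Space H Λ) ξ⟫_ℂ).re ≤
      (⟪ξ, (amplify h (𝓛.Ψ t Z) (star T * T) : Space H Λ →L[ℂ] Space H Λ) ξ⟫_ℂ).re} := by
    have h1 : ∀ f : Obs H Λ → Obs H Λ, Continuous f →
        Continuous fun T => (f T : Space H Λ →L[ℂ] Space H Λ) ξ := fun f hf =>
      (continuous_subtype_val.comp hf).clm_apply continuous_const
    have h2 := h1 _ continuous_id
    have h3 := h1 _ (amplify h (𝓛.Ψ t Z)).continuous
    have h4 := h1 _ ((amplify h (𝓛.Ψ t Z)).continuous.comp (continuous_star.mul continuous_id))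
    exact isClosed_le (continuous_const.mul (Complex.continuous_re.comp (h2.inner h3)))
      (Complex.continuous_re.comp (continuous_const.inner h4))
  have hsub : (productSums H h : Set (Obs H Λ)) ⊆ _ := fun T (hT : T ∈ productSums H h) => by
    -- Strong convergence is known only on sums of products; these form a star algebra, so both
    -- sides of the inequality can be passed to the limit.
    have hTT : star T * T ∈ productSums H h :=
      mul_mem (S := StarSubalgebra ℂ (Obs H Λ)) (s := productAlg h) (star_mem (s := productAlg h) hT) hT
    have hΦ : star (embed H h (𝓛.Φ t Z)) = embed H h (𝓛.Φ t Z) := by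
      rw [← map_star, 𝓛.selfAdjoint]
    have h1 := 𝓛.tendsto_amplify t h hT ξ
    have h2 := 𝓛.tendsto_amplify t h hTT ξ
    exact le_of_tendsto_of_tendsto'
      (((Complex.continuous_re.tendsto _).comp (tendsto_const_nhds.inner h1)).const_mul 2)
      ((Complex.continuous_re.tendsto _).comp (tendsto_const_nhds.inner h2))
      fun n => re_inner_lindblad hΦ _ n T ξ
  exact closure_minimal hsub hcl (dense_productSums (H := H) h T)

end Lattice

/-! ### Norm comparison for dissipative evolution equations. -/

section Comparison

/-- A differential inequality for the norm of a solution of `f' = M f + g` with dissipative `M`. -/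
theorem norm_le_of_dissipative {E : Type*} [NormedAddCommGroup E] [NormedSpace ℂ E]
    {f g : ℝ → E} {M : ℝ → E →L[ℂ] E} {s t : ℝ} {φ φ' : ℝ → ℝ}
    (hM : ∀ r ∈ Set.Ico s t, ∃ c : ℝ, ∀ ε : ℝ, 0 ≤ ε → ∀ a : E,
      ‖a + (ε : ℂ) • M r a‖ ≤ (1 + c * ε ^ 2) * ‖a‖)
    (hf : ContinuousOn f (Set.Icc s t))
    (hf' : ∀ r ∈ Set.Ico s t, HasDerivWithinAt f (M r (f r) + g r) (Set.Ici r) r)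
    (hφ : ∀ r, HasDerivAt φ (φ' r) r) (hs : ‖f s‖ ≤ φ s)
    (hg : ∀ r ∈ Set.Ico s t, ‖g r‖ ≤ φ' r) :
    ∀ r ∈ Set.Icc s t, ‖f r‖ ≤ φ r := by
  refine image_le_of_liminf_slope_right_le_deriv_boundary hf.norm hs
    (fun r _ => (hφ r).continuousAt.continuousWithinAt) (fun r _ => (hφ r).hasDerivWithinAt) ?_
  intro x hx r hr
  obtain ⟨c, hc⟩ := hM x hx
  refine Eventually.frequently ?_
  have hslope : Tendsto (slope f x) (𝓝[>] x) (𝓝 (M x (f x) + g x)) := by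
    exact (hasDerivWithinAt_iff_tendsto_slope' (lt_irrefl x)).mp (hf' x hx).Ioi_of_Ici
  have hbound : ∀ z ∈ Set.Ioi x, slope (fun y => ‖f y‖) x z ≤
      c * (z - x) * ‖f x‖ + ‖g x‖ + ‖slope f x z - (M x (f x) + g x)‖ := by
    intro z hz
    have hz' : 0 < z - x := sub_pos.mpr hz
    -- Keeping `f x` and its `M`-increment together lets `hM` apply: they contribute only
    -- second-order growth, so the right derivative of the norm is governed by `‖g x‖`.
    have h1 : f z = (f x + ((z - x : ℝ) : ℂ) • M x (f x)) + (z - x) • g x +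
        (z - x) • (slope f x z - (M x (f x) + g x)) := by
      have h2 : (z - x) • slope f x z = f z - f x := sub_smul_slope f x z
      have h3 : ((z - x : ℝ) : ℂ) • M x (f x) = (z - x) • M x (f x) := RCLike.real_smul_eq_coe_smul (K := ℂ) _ _ |>.symm
      rw [h3, smul_sub, h2, smul_add]
      abel
    have h4 : ‖f z‖ ≤ (1 + c * (z - x) ^ 2) * ‖f x‖ + (z - x) * ‖g x‖ +
        (z - x) * ‖slope f x z - (M x (f x) + g x)‖ := by
      calc ‖f z‖ ≤ ‖f x + ((z - x : ℝ) : ℂ) • M x (f x)‖ + ‖(z - x) • g x‖ +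
            ‖(z - x) • (slope f x z - (M x (f x) + g x))‖ := by
            conv_lhs => rw [h1]
            exact norm_add₃_le
        _ ≤ _ := by
            rw [norm_smul, norm_smul, Real.norm_of_nonneg hz'.le]
            gcongr
            exact hc _ hz'.le _
    rw [slope_def_field, div_le_iff₀ hz']
    nlinarith [h4]
  have hlim : Tendsto (fun z => c * (z - x) * ‖f x‖ + ‖g x‖ +
      ‖slope f x z - (M x (f x) + g x)‖) (𝓝[>] x) (𝓝 ‖g x‖) := by
    have h1 : Tendsto (fun z => c * (z - x) * ‖f x‖ + ‖g x‖) (𝓝[>] x) (𝓝 (c * (x - x) * ‖f x‖ + ‖g x‖)) :=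
      (Continuous.tendsto (by fun_prop) x).mono_left nhdsWithin_le_nhds
    have h2 := (hslope.sub_const (M x (f x) + g x)).norm
    simpa using h1.add h2
  filter_upwards [hlim.eventually_lt_const ((hg x hx).trans_lt hr), self_mem_nhdsWithin] with z hz hz'
  exact (hbound z hz').trans_lt hz

end Comparison

/-! ### Solutions by the Dyson series. -/

section Propagator

variable {E : Type*} [NormedAddCommGroup E] [NormedSpace ℂ E]

/-- The terms of the Dyson series of `A' = L(r) A`, `A(s) = a`. -/
def dysonTerm (L : ℝ → E →L[ℂ] E) (s : ℝ) (a : E) : ℕ → ℝ → E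
  | 0, _ => a
  | n + 1, r => ∫ u in s..r, L u (dysonTerm L s a n u)

variable {L : ℝ → E →L[ℂ] E}

theorem continuous_dysonTerm (hL : Continuous L) (s : ℝ) (a : E) (n : ℕ) :
    Continuous (dysonTerm L s a n) := by
  induction n with
  | zero => exact continuous_const
  | succ n ih =>
    exact intervalIntegral.continuous_primitive
      (fun b c => (hL.clm_apply ih).intervalIntegrable b c) s

theorem hasDerivAt_dysonTerm [CompleteSpace E] (hL : Continuous L) (s : ℝ) (a : E) (n : ℕ) (r : ℝ) :
    HasDerivAt (dysonTerm L s a (n + 1)) (L r (dysonTerm L s a n r)) r :=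
  (hL.clm_apply (continuous_dysonTerm hL s a n)).integral_hasStrictDerivAt s r |>.hasDerivAt

theorem norm_dysonTerm_le (hL : Continuous L) {s R M : ℝ}
    (hM : ∀ r, |r - s| ≤ R → ‖L r‖ ≤ M) (a : E) (n : ℕ) {r : ℝ} (hr : |r - s| ≤ R) :
    ‖dysonTerm L s a n r‖ ≤ ‖a‖ * M ^ n * |r - s| ^ n / n.factorial := by
  induction n generalizing r with
  | zero => simp [dysonTerm]
  | succ n ih =>
    have hle : ∀ u ∈ Set.uIoc s r, ‖L u (dysonTerm L s a n u)‖ ≤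
        ‖a‖ * M ^ (n + 1) / n.factorial * |u - s| ^ n := by
      intro u hu
      have hus : |u - s| ≤ R :=
        (Set.abs_sub_left_of_mem_uIcc (Set.uIoc_subset_uIcc hu)).trans hr
      calc _ ≤ M * (‖a‖ * M ^ n * |u - s| ^ n / n.factorial) :=
            (L u).le_of_opNorm_le_of_le (hM u hus) (ih hus)
        _ = _ := by ring
    calc _ ≤ ∫ u in Set.uIoc s r, ‖L u (dysonTerm L s a n u)‖ :=
          intervalIntegral.norm_integral_le_integral_norm_uIoc
      _ ≤ ∫ u in Set.uIoc s r, ‖a‖ * M ^ (n + 1) / n.factorial * |u - s| ^ n := by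
          refine MeasureTheory.setIntegral_mono_on ?_ ?_ measurableSet_uIoc hle
          · exact ((hL.clm_apply (continuous_dysonTerm hL s a n)).norm.integrableOn_uIcc
              (a := s) (b := r)).mono_set Set.uIoc_subset_uIcc
          · exact (Continuous.integrableOn_uIcc (by fun_prop)).mono_set Set.uIoc_subset_uIcc
      _ = _ := by
          rw [MeasureTheory.integral_const_mul, integral_pow_abs_sub_uIoc, Nat.factorial_succ,
            Nat.cast_mul, Nat.cast_add_one]
          field_simp

/-- Existence of solutions of linear evolution equations with norm-continuous coefficients. -/
theorem exists_hasDerivAt_clm [CompleteSpace E] (hL : Continuous L) (s : ℝ) (a : E) :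
    ∃ A : ℝ → E, A s = a ∧ ∀ r, HasDerivAt A (L r (A r)) r := by
  have hbound : ∀ R, ∃ M, 0 ≤ M ∧ ∀ r, |r - s| ≤ R → ‖L r‖ ≤ M := by
    intro R
    obtain ⟨M, hM⟩ := (isCompact_closedBall s R).exists_bound_of_continuousOn hL.continuousOn
    exact ⟨max M 0, le_max_right _ _, fun r hr =>
      (hM r (by rwa [Metric.mem_closedBall, Real.dist_eq])).trans (le_max_left _ _)⟩
  have hsum : ∀ r, Summable fun n => dysonTerm L s a n r := by
    intro r
    obtain ⟨M, hM0, hM⟩ := hbound |r - s|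
    refine Summable.of_norm_bounded ((Real.summable_pow_div_factorial (M * |r - s|)).mul_left ‖a‖)
      fun n => (norm_dysonTerm_le hL hM a n le_rfl).trans_eq ?_
    rw [mul_pow]
    ring
  refine ⟨fun r => ∑' n, dysonTerm L s a n r, ?_, fun r => ?_⟩
  · refine (tsum_eq_single 0 fun n hn => ?_).trans rfl
    obtain ⟨n, rfl⟩ := Nat.exists_eq_succ_of_ne_zero hn
    exact intervalIntegral.integral_same
  -- The extra `1` places `r` inside an open ball on which the differentiated series has a summable
  -- majorant.
  · set R := |r - s| + 1 with hR
    obtain ⟨M, hM0, hM⟩ := hbound R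
    have hR0 : 0 ≤ R := by positivity
    -- Differentiation lowers the index: the constant term contributes zero, and the shifted series
    -- sums to `L r (A r)`.
    let g' : ℕ → ℝ → E := fun n => n.casesOn (fun _ => 0) fun n r => L r (dysonTerm L s a n r)
    let u : ℕ → ℝ := fun n => n.casesOn 0 fun n => M * (‖a‖ * ((M * R) ^ n / n.factorial))
    have hu : Summable u := (summable_nat_add_iff 1).mp
      (((Real.summable_pow_div_factorial (M * R)).mul_left ‖a‖).mul_left M)
    have hmem : ∀ y ∈ Metric.ball s R, |y - s| ≤ R := fun y hy => by
      rw [Metric.mem_ball, Real.dist_eq] at hy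
      exact hy.le
    have hd := hasDerivAt_tsum_of_isPreconnected (t := Metric.ball s R) (y₀ := s) (y := r)
      (g := dysonTerm L s a) (g' := g') hu Metric.isOpen_ball
      (convex_ball s R).isPreconnected (fun n y _ => ?_) (fun n y hy => ?_)
      (Metric.mem_ball_self (by positivity)) (hsum s) (by
        rw [Metric.mem_ball, Real.dist_eq]
        exact lt_add_one _)
    · refine hd.congr_deriv ?_
      have hg' : Summable fun n => g' n r := (summable_nat_add_iff 1).mp ((hsum r).mapL (L r))
      rw [hg'.tsum_eq_zero_add, ContinuousLinearMap.map_tsum _ (hsum r)]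
      exact zero_add _
    · cases n with
      | zero => exact hasDerivAt_const y a
      | succ n => exact hasDerivAt_dysonTerm hL s a n y
    · cases n with
      | zero => exact norm_zero.le
      | succ n =>
        refine (L y).le_of_opNorm_le_of_le (hM y (hmem y hy))
          ((norm_dysonTerm_le hL hM a n (hmem y hy)).trans ?_)
        rw [mul_pow, ← mul_div_assoc, ← mul_assoc]
        have := hmem y hy
        gcongr

/-- The propagator solves the evolution equation. -/
theorem exists_propagator_eq [CompleteSpace E] (hL : Continuous L) (s : ℝ) (a : E) :
    ∃ A : ℝ → E, A s = a ∧ (∀ r ∈ Set.Ici s, HasDerivWithinAt A (L r (A r)) (Set.Ici s) r) ∧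
      ∀ t, propagator L t s a = A t := by
  have h : ∃ A : ℝ → E, A s = a ∧
      ∀ r ∈ Set.Ici s, HasDerivWithinAt A (L r (A r)) (Set.Ici s) r :=
    (exists_hasDerivAt_clm hL s a).imp fun A hA => ⟨hA.1, fun r _ => (hA.2 r).hasDerivWithinAt⟩
  exact ⟨h.choose, h.choose_spec.1, h.choose_spec.2, fun t => dif_pos h⟩

end Propagator

/-! ### Summing weights over sets and the convolution condition. -/

section Weights

variable {Γ : Type*} {Λ X Y : Finset Γ} {G : Γ → Γ → ℝ} {N C : ℝ}

theorem sum_convolution_le (hX : X ⊆ Λ) (hY : Y ⊆ Λ)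
    (hC : ∀ x ∈ Λ, ∀ y ∈ Λ, ∑ z ∈ Λ, G x z * G z y ≤ C * G x y) :
    ∑ x ∈ X, ∑ z ∈ Λ, G x z * ∑ y ∈ Y, G z y ≤ C * ∑ x ∈ X, ∑ y ∈ Y, G x y := by
  rw [Finset.mul_sum]
  refine Finset.sum_le_sum fun x hx => ?_
  simp only [Finset.mul_sum]
  rw [Finset.sum_comm]
  exact Finset.sum_le_sum fun y hy => hC x (hX hx) y (hY hy)

variable [DecidableEq Γ]

/-- Summation over the sets that meet `X`. -/
theorem sum_not_disjoint_le (hX : X ⊆ Λ) {β : Finset Γ → ℝ} (hβ : ∀ Z, 0 ≤ β Z)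
    (hN : ∀ x ∈ Λ, ∀ y ∈ Λ, ∑ Z ∈ Λ.powerset with x ∈ Z ∧ y ∈ Z, β Z ≤ N * G x y)
    {g : Γ → ℝ} (hg : ∀ z, 0 ≤ g z) :
    ∑ Z ∈ Λ.powerset with ¬ Disjoint X Z, β Z * ∑ z ∈ Z, g z ≤
      N * ∑ x ∈ X, ∑ z ∈ Λ, G x z * g z := by
  calc ∑ Z ∈ Λ.powerset with ¬ Disjoint X Z, β Z * ∑ z ∈ Z, g z
      ≤ ∑ Z ∈ Λ.powerset, ∑ x ∈ X, ∑ z ∈ Λ, if x ∈ Z ∧ z ∈ Z then β Z * g z else 0 := by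
        rw [Finset.sum_filter]
        refine Finset.sum_le_sum fun Z hZ => ?_
        have h0 : ∀ x z, 0 ≤ if x ∈ Z ∧ z ∈ Z then β Z * g z else 0 := fun x z => by
          split_ifs
          exacts [mul_nonneg (hβ Z) (hg z), le_rfl]
        split_ifs with h
        · exact Finset.sum_nonneg fun x _ => Finset.sum_nonneg fun z _ => h0 x z
        -- One point of `X ∩ Z` suffices: its row in the double sum already equals the contribution
        -- of `Z`.
        · obtain ⟨x, hxX, hxZ⟩ := Finset.not_disjoint_iff.mp h
          refine le_trans (le_of_eq ?_) (Finset.single_le_sum (f := fun x => ∑ z ∈ Λ,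
            if x ∈ Z ∧ z ∈ Z then β Z * g z else 0)
            (fun x _ => Finset.sum_nonneg fun z _ => h0 x z) hxX)
          simp only [hxZ, true_and]
          rw [← Finset.sum_filter, Finset.filter_mem_eq_inter,
            Finset.inter_eq_right.mpr (Finset.mem_powerset.mp hZ), Finset.mul_sum]
    _ = ∑ x ∈ X, ∑ z ∈ Λ, (∑ Z ∈ Λ.powerset with x ∈ Z ∧ z ∈ Z, β Z) * g z := by
        rw [Finset.sum_comm]
        refine Finset.sum_congr rfl fun x _ => ?_
        rw [Finset.sum_comm]
        refine Finset.sum_congr rfl fun z _ => ?_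
        rw [Finset.sum_mul, Finset.sum_filter]
    _ ≤ ∑ x ∈ X, ∑ z ∈ Λ, N * G x z * g z :=
        Finset.sum_le_sum fun x hx => Finset.sum_le_sum fun z hz =>
          mul_le_mul_of_nonneg_right (hN x (hX hx) z hz) (hg z)
    _ = N * ∑ x ∈ X, ∑ z ∈ Λ, G x z * g z := by
        simp only [Finset.mul_sum, mul_assoc]

/-- One step of the Lieb-Robinson iteration for the weights. -/
theorem sum_weights_le (hX : X ⊆ Λ) (hY : Y ⊆ Λ) {β : Finset Γ → ℝ} (hβ : ∀ Z, 0 ≤ β Z)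
    (hG : ∀ x y, 0 ≤ G x y) (hN0 : 0 ≤ N)
    (hN : ∀ x ∈ Λ, ∀ y ∈ Λ, ∑ Z ∈ Λ.powerset with x ∈ Z ∧ y ∈ Z, β Z ≤ N * G x y)
    (hC : ∀ x ∈ Λ, ∀ y ∈ Λ, ∑ z ∈ Λ, G x z * G z y ≤ C * G x y)
    {b e η : ℝ} (hb : 0 ≤ b) (he : 0 ≤ e) (hη : 0 ≤ η) :
    ∑ Z ∈ Λ.powerset with ¬ Disjoint X Z, β Z *
      (b * ((if Disjoint Z Y then 0 else 1) + e * ∑ z ∈ Z, ∑ y ∈ Y, G z y) +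
        η * ∑ z ∈ Z, ∑ y ∈ Λ, G z y) ≤
      b * (N * (1 + C * e) * ∑ x ∈ X, ∑ y ∈ Y, G x y) +
        η * (N * C) * ∑ x ∈ X, ∑ y ∈ Λ, G x y := by
  -- Replacing the indicator that `Z` meets `Y` by the number of points of `Z` in `Y` makes the
  -- weight additive over the points of `Z`.
  let g : Γ → ℝ := fun z => b * ((if z ∈ Y then 1 else 0) + e * ∑ y ∈ Y, G z y) +
    η * ∑ y ∈ Λ, G z y
  have hsum : ∀ (Z : Finset Γ) (z : Γ), 0 ≤ ∑ y ∈ Z, G z y := fun Z z =>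
    Finset.sum_nonneg fun y _ => hG z y
  have hind : ∀ z, (0 : ℝ) ≤ if z ∈ Y then 1 else 0 := fun z => by
    split_ifs <;> norm_num
  have hg : ∀ z, 0 ≤ g z := fun z => by
    have := hsum Y z
    have := hsum Λ z
    have := hind z
    positivity
  calc _ ≤ ∑ Z ∈ Λ.powerset with ¬ Disjoint X Z, β Z * ∑ z ∈ Z, g z := by
        refine Finset.sum_le_sum fun Z _ => mul_le_mul_of_nonneg_left ?_ (hβ Z)
        simp only [g, Finset.sum_add_distrib, ← Finset.mul_sum]
        gcongr
        split_ifs with h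
        · exact Finset.sum_nonneg fun z _ => hind z
        · obtain ⟨z, hzZ, hzY⟩ := Finset.not_disjoint_iff.mp h
          have := Finset.single_le_sum (fun z _ => hind z) hzZ
          rwa [if_pos hzY] at this
    _ ≤ N * ∑ x ∈ X, ∑ z ∈ Λ, G x z * g z := sum_not_disjoint_le hX hβ hN hg
    _ = N * (b * (∑ x ∈ X, ∑ y ∈ Y, G x y + e * ∑ x ∈ X, ∑ z ∈ Λ, G x z * ∑ y ∈ Y, G z y) +
          η * ∑ x ∈ X, ∑ z ∈ Λ, G x z * ∑ y ∈ Λ, G z y) := by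
        have h1 : ∀ x, ∑ z ∈ Λ, G x z * (if z ∈ Y then 1 else 0) = ∑ y ∈ Y, G x y := fun x => by
          simp only [mul_ite, mul_one, mul_zero]
          rw [← Finset.sum_filter, Finset.filter_mem_eq_inter, Finset.inter_eq_right.mpr hY]
        have h2 : ∀ x z, G x z * g z = b * (G x z * (if z ∈ Y then 1 else 0)) +
            b * e * (G x z * ∑ y ∈ Y, G z y) + η * (G x z * ∑ y ∈ Λ, G z y) := fun x z => by
          simp only [g]
          ring
        simp only [h2, Finset.sum_add_distrib, ← Finset.mul_sum, h1]
        ring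
    _ ≤ N * (b * (∑ x ∈ X, ∑ y ∈ Y, G x y + e * (C * ∑ x ∈ X, ∑ y ∈ Y, G x y)) +
          η * (C * ∑ x ∈ X, ∑ y ∈ Λ, G x y)) := by
        gcongr
        · exact sum_convolution_le hX hY hC
        · exact sum_convolution_le hX le_rfl hC
    _ = _ := by ring

end Weights

/-! ### The Lieb-Robinson iteration. -/

section Iteration

theorem hasDerivWithinAt_clm_comp {E F : Type*} [NormedAddCommGroup E] [NormedSpace ℂ E]
    [NormedAddCommGroup F] [NormedSpace ℂ F] (K : E →L[ℂ] F) {f : ℝ → E} {f' : E} {S : Set ℝ}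
    {r : ℝ} (hf : HasDerivWithinAt f f' S r) : HasDerivWithinAt (fun r => K (f r)) (K f') S r :=
  (K.restrictScalars ℝ).hasFDerivAt.comp_hasDerivWithinAt r hf

theorem map_sum_apply_eq {E ι : Type*} [NormedAddCommGroup E] [NormedSpace ℂ E] {I : Finset ι}
    {p : ι → Prop} [DecidablePred p] (P : ι → E →L[ℂ] E) (K : E →L[ℂ] E)
    (h : ∀ i ∈ I, p i → ∀ a, K (P i a) = P i (K a)) (a : E) :
    K ((∑ i ∈ I, P i) a) = (∑ i ∈ I with p i, P i) (K a) + ∑ i ∈ I with ¬ p i, K (P i a) := by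
  rw [sum_apply, map_sum, ← Finset.sum_filter_add_sum_filter_not I p, sum_apply]
  refine congrArg (· + _) (Finset.sum_congr rfl fun i hi => ?_)
  exact h i (Finset.mem_filter.mp hi).1 (Finset.mem_filter.mp hi).2 a

variable {Γ : Type*} [DecidableEq Γ] {H : Γ → Type*} [∀ x, NormedAddCommGroup (H x)]
  [∀ x, InnerProductSpace ℂ (H x)] [∀ x, CompleteSpace (H x)] {Λ X Y : Finset Γ}

/-- The differential inequality that drives the Lieb-Robinson iteration. -/
theorem LindbladFamily.norm_amplify_le_of_deriv (𝓛 : LindbladFamily H) (hX : X ⊆ Λ) (hY : Y ⊆ Λ)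
    {s t : ℝ} {B : Obs H Y} {A : ℝ → Obs H Λ} (hA0 : A s = embed H hY B)
    (hA : ∀ r ∈ Set.Ici s, HasDerivWithinAt A (𝓛.generator Λ r (A r)) (Set.Ici s) r)
    {φ φ' : ℝ → ℝ} (hφ : ∀ r, HasDerivAt φ (φ' r) r)
    (hφ0 : ‖B‖ * (if Disjoint X Y then 0 else 1) ≤ φ s) {h : ℝ → Finset Γ → ℝ}
    (hh : ∀ r ∈ Set.Ico s t, ∀ (Z : Finset Γ) (hZ : Z ⊆ Λ), Z.Nonempty →
      ‖amplify hZ (𝓛.Ψ r Z) (A r)‖ ≤ (cbNorm (𝓛.Ψ r Z)).toReal * h r Z)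
    (hφ' : ∀ r ∈ Set.Ico s t, ∑ Z ∈ Λ.powerset with ¬ Disjoint X Z,
      (cbNorm (𝓛.Ψ r Z)).toReal * h r Z ≤ φ' r)
    {K : Obs H X →L[ℂ] Obs H X} (hK : cbNorm K < ∞) (hK1 : K 1 = 0) :
    ∀ r ∈ Set.Icc s t, ‖amplify hX K (A r)‖ ≤ (cbNorm K).toReal * φ r := by
  classical
  set k := (cbNorm K).toReal with hk
  have hk0 : 0 ≤ k := ENNReal.toReal_nonneg
  let P : {Z // Z ∈ Λ.powerset} → ℝ → Obs H Λ →L[ℂ] Obs H Λ := fun Z r =>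
    amplify (Finset.mem_powerset.mp Z.2) (𝓛.Ψ r Z)
  let M : ℝ → Obs H Λ →L[ℂ] Obs H Λ := fun r =>
    ∑ Z ∈ Λ.powerset.attach with Disjoint X Z.1, P Z r
  let g : ℝ → Obs H Λ := fun r =>
    ∑ Z ∈ Λ.powerset.attach with ¬ Disjoint X Z.1, amplify hX K (P Z r (A r))
  have hM : ∀ r, IsDissipative (M r) := fun r =>
    isDissipative_sum _ fun Z _ => 𝓛.isDissipative_amplify r _
  have hsplit : ∀ r, amplify hX K (𝓛.generator Λ r (A r)) = M r (amplify hX K (A r)) + g r := by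
    intro r
    -- Only the terms with `Z` disjoint from `X` are moved past `K`; they form the dissipative part,
    -- the others the source.
    exact map_sum_apply_eq (fun Z => P Z r) (amplify hX K) (fun Z _ hZ a =>
      amplify_comm hX _ hZ hK (𝓛.completelyBounded r Z) a) (A r)
  refine norm_le_of_dissipative (f := fun r => amplify hX K (A r)) (g := g) (M := M)
    (φ := fun r => k * φ r) (φ' := fun r => k * φ' r) ?_ ?_ ?_ ?_ ?_ ?_
  · intro r _
    refine ⟨‖M r‖ ^ 2, fun ε hε a => ?_⟩
    have := (hM r).norm_add_smul_le hε a
    rwa [mul_pow, mul_comm (ε ^ 2)] at this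
  · exact (amplify hX K).continuous.comp_continuousOn fun r hr =>
      ((hA r hr.1).continuousWithinAt).mono Set.Icc_subset_Ici_self
  · intro r hr
    have h1 := hasDerivWithinAt_clm_comp (E := Obs H Λ) (F := Obs H Λ) (amplify hX K)
      ((hA r hr.1).mono (Set.Ici_subset_Ici.mpr hr.1))
    rw [hsplit] at h1
    exact h1
  · exact fun r => (hφ r).const_mul k
  · rw [hA0]
    refine le_trans ?_ (mul_le_mul_of_nonneg_left hφ0 hk0)
    split_ifs with hd
    · rw [amplify_embed_of_disjoint hX hY hd hK hK1, norm_zero, mul_zero, mul_zero]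
    · rw [mul_one]
      exact (norm_amplify_le hX hK _).trans
        (mul_le_mul_of_nonneg_left (embed_norm_le hY B) hk0)
  · intro r hr
    calc ‖g r‖ ≤ ∑ Z ∈ Λ.powerset.attach with ¬ Disjoint X Z.1,
          k * ((cbNorm (𝓛.Ψ r Z)).toReal * h r Z) := by
          refine norm_sum_le_of_le _ fun Z hZ => ?_
          refine (norm_amplify_le hX hK _).trans (mul_le_mul_of_nonneg_left ?_ hk0)
          refine hh r hr Z _ ?_
          obtain ⟨x, _, hx⟩ := Finset.not_disjoint_iff.mp (Finset.mem_filter.mp hZ).2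
          exact ⟨x, hx⟩
      _ = k * ∑ Z ∈ Λ.powerset with ¬ Disjoint X Z, (cbNorm (𝓛.Ψ r Z)).toReal * h r Z := by
          rw [Finset.sum_filter, Finset.sum_filter, Finset.mul_sum,
            Finset.sum_attach Λ.powerset (fun Z => if ¬ Disjoint X Z then
              k * ((cbNorm (𝓛.Ψ r Z)).toReal * h r Z) else 0)]
          refine Finset.sum_congr rfl fun Z _ => ?_
          rw [mul_ite, mul_zero]
      _ ≤ k * φ' r := mul_le_mul_of_nonneg_left (hφ' r hr) hk0

/-- The Lieb-Robinson bound for a solution of the evolution equation. -/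
theorem LindbladFamily.norm_amplify_le_exp (𝓛 : LindbladFamily H) (hX : X ⊆ Λ) (hY : Y ⊆ Λ)
    {G : Γ → Γ → ℝ} {N C : ℝ} (hG : ∀ x y, 0 < G x y) (hN0 : 0 ≤ N) (hC0 : 0 < C) {s t : ℝ}
    (hst : s ≤ t)
    (hN : ∀ r ∈ Set.Ico s t, ∀ x ∈ Λ, ∀ y ∈ Λ,
      ∑ Z ∈ Λ.powerset with x ∈ Z ∧ y ∈ Z, (cbNorm (𝓛.Ψ r Z)).toReal ≤ N * G x y)
    (hC : ∀ x ∈ Λ, ∀ y ∈ Λ, ∑ z ∈ Λ, G x z * G z y ≤ C * G x y)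
    {B : Obs H Y} {A : ℝ → Obs H Λ} (hA0 : A s = embed H hY B)
    (hA : ∀ r ∈ Set.Ici s, HasDerivWithinAt A (𝓛.generator Λ r (A r)) (Set.Ici s) r)
    {K : Obs H X →L[ℂ] Obs H X} (hK : cbNorm K < ∞) (hK1 : K 1 = 0) :
    ‖amplify hX K (A t)‖ ≤ (cbNorm K).toReal * (‖B‖ * ((if Disjoint X Y then 0 else 1) +
      (Real.exp (N * C * (t - s)) - 1) / C * ∑ x ∈ X, ∑ y ∈ Y, G x y)) := by
  let E : ℝ → ℝ := fun r => (Real.exp (N * C * (r - s)) - 1) / C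
  have hE : ∀ r, HasDerivAt E (N * (1 + C * E r)) r := by
    intro r
    have h1 := (((((hasDerivAt_id r).sub_const s).const_mul (N * C)).exp).sub_const 1).div_const C
    refine h1.congr_deriv ?_
    simp only [E, id]
    field_simp
    ring
  have hE0 : ∀ r, s ≤ r → 0 ≤ E r := by
    intro r hr
    refine div_nonneg ?_ hC0.le
    have : 0 ≤ N * C * (r - s) := mul_nonneg (mul_nonneg hN0 hC0.le) (sub_nonneg.mpr hr)
    linarith [Real.add_one_le_exp (N * C * (r - s))]
  -- A crude bound by compactness is enough, since it enters only the vanishing error.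
  obtain ⟨a, ha⟩ : ∃ a, ∀ r ∈ Set.Icc s t, ‖A r‖ ≤ a := by
    refine isCompact_Icc.exists_bound_of_continuousOn fun r hr => ?_
    exact ((hA r hr.1).continuousWithinAt).mono Set.Icc_subset_Ici_self
  have ha0 : 0 ≤ a := (norm_nonneg _).trans (ha s (Set.left_mem_Icc.mpr hst))
  let η : ℕ → ℝ → ℝ := fun n r => (N * C * (r - s)) ^ n / n.factorial
  have hη0 : ∀ n r, s ≤ r → 0 ≤ η n r := fun n r hr => by
    have : 0 ≤ N * C * (r - s) := mul_nonneg (mul_nonneg hN0 hC0.le) (sub_nonneg.mpr hr)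
    positivity
  have hη : ∀ n r, HasDerivAt (η (n + 1)) (N * C * η n r) r := by
    intro n r
    have h1 := ((((hasDerivAt_id r).sub_const s).const_mul (N * C)).pow (n + 1)).div_const
      ((n + 1).factorial : ℝ)
    refine h1.congr_deriv ?_
    simp only [η, id, Nat.factorial_succ, Nat.cast_mul, Nat.add_sub_cancel]
    have : (n.factorial : ℝ) ≠ 0 := by positivity
    have : ((n + 1 : ℕ) : ℝ) ≠ 0 := by positivity
    field_simp
  have hwpos : ∀ Z : Finset Γ, Z ⊆ Λ → Z.Nonempty → 0 < ∑ x ∈ Z, ∑ y ∈ Λ, G x y :=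
    fun Z hZ hne => Finset.sum_pos (fun x hx => Finset.sum_pos (fun y _ => hG x y) ⟨x, hZ hx⟩) hne
  obtain ⟨c, hc0, hc⟩ : ∃ c, 0 ≤ c ∧ ∀ Z : Finset Γ, Z ⊆ Λ → Z.Nonempty →
      a ≤ c * ∑ x ∈ Z, ∑ y ∈ Λ, G x y := by
    -- A sum over the finitely many `Z` dominates each ratio. Nonempty sets are needed because the
    -- weight of the empty set is zero.
    refine ⟨∑ Z ∈ Λ.powerset, a / ∑ x ∈ Z, ∑ y ∈ Λ, G x y, ?_, fun Z hZ hne => ?_⟩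
    · exact Finset.sum_nonneg fun Z _ => div_nonneg ha0
        (Finset.sum_nonneg fun x _ => Finset.sum_nonneg fun y _ => (hG x y).le)
    · rw [← div_le_iff₀ (hwpos Z hZ hne)]
      exact Finset.single_le_sum (f := fun Z => a / ∑ x ∈ Z, ∑ y ∈ Λ, G x y)
        (fun Z _ => div_nonneg ha0 (Finset.sum_nonneg fun x _ =>
          Finset.sum_nonneg fun y _ => (hG x y).le)) (Finset.mem_powerset.mpr hZ)
  -- The first part is the claimed bound. The error uses the weight against all of `Λ`, which one
  -- step reproduces up to the factor `N C`.
  let u : ℕ → ℝ → Finset Γ → ℝ := fun n r Z =>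
    ‖B‖ * ((if Disjoint Z Y then 0 else 1) + E r * ∑ x ∈ Z, ∑ y ∈ Y, G x y) +
      c * η n r * ∑ x ∈ Z, ∑ y ∈ Λ, G x y
  have step : ∀ n, (∀ r ∈ Set.Ico s t, ∀ (Z : Finset Γ) (hZ : Z ⊆ Λ), Z.Nonempty →
      ‖amplify hZ (𝓛.Ψ r Z) (A r)‖ ≤ (cbNorm (𝓛.Ψ r Z)).toReal * u n r Z) →
      ∀ (Z : Finset Γ) (hZ : Z ⊆ Λ) (K : Obs H Z →L[ℂ] Obs H Z), cbNorm K < ∞ → K 1 = 0 →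
      ∀ r ∈ Set.Icc s t, ‖amplify hZ K (A r)‖ ≤ (cbNorm K).toReal * u (n + 1) r Z := by
    intro n ih Z hZ K hK hK1
    refine 𝓛.norm_amplify_le_of_deriv hZ hY hA0 hA (φ := fun r => u (n + 1) r Z)
      (φ' := fun r => ‖B‖ * (N * (1 + C * E r) * ∑ x ∈ Z, ∑ y ∈ Y, G x y) +
        c * η n r * (N * C) * ∑ x ∈ Z, ∑ y ∈ Λ, G x y) (h := fun r => u n r) ?_ ?_ ih ?_ hK hK1
    · intro r
      refine (((((hE r).mul_const _).const_add _).const_mul ‖B‖).add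
        (((hη n r).const_mul c).mul_const _)).congr_deriv ?_
      ring
    -- Both `E` and `η (n + 1)` vanish at `s`, leaving the initial value.
    · simp [u, η, E]
    · intro r hr
      exact sum_weights_le hZ hY (fun Z => ENNReal.toReal_nonneg) (fun x y => (hG x y).le) hN0
        (hN r hr) hC (norm_nonneg B) (hE0 r hr.1) (mul_nonneg hc0 (hη0 n r hr.1))
  have base : ∀ r ∈ Set.Ico s t, ∀ (Z : Finset Γ) (hZ : Z ⊆ Λ), Z.Nonempty →
      ‖amplify hZ (𝓛.Ψ r Z) (A r)‖ ≤ (cbNorm (𝓛.Ψ r Z)).toReal * u 0 r Z := by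
    intro r hr Z hZ hne
    refine (norm_amplify_le hZ (𝓛.completelyBounded r Z) _).trans
      (mul_le_mul_of_nonneg_left ?_ ENNReal.toReal_nonneg)
    refine (ha r (Set.Ico_subset_Icc_self hr)).trans ((hc Z hZ hne).trans ?_)
    have h1 : (0 : ℝ) ≤ if Disjoint Z Y then 0 else 1 := by split_ifs <;> norm_num
    have h2 := hE0 r hr.1
    have h3 : 0 ≤ ∑ x ∈ Z, ∑ y ∈ Y, G x y :=
      Finset.sum_nonneg fun x _ => Finset.sum_nonneg fun y _ => (hG x y).le
    have h4 : η 0 r = 1 := by simp [η]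
    simp only [u, h4, mul_one]
    exact le_add_of_nonneg_left (by positivity)
  have all : ∀ n, ∀ r ∈ Set.Ico s t, ∀ (Z : Finset Γ) (hZ : Z ⊆ Λ), Z.Nonempty →
      ‖amplify hZ (𝓛.Ψ r Z) (A r)‖ ≤ (cbNorm (𝓛.Ψ r Z)).toReal * u n r Z := by
    intro n
    induction n with
    | zero => exact base
    | succ n ih =>
      exact fun r hr Z hZ _ => step n ih Z hZ (𝓛.Ψ r Z) (𝓛.completelyBounded r Z) (𝓛.map_one r Z) r
        (Set.Ico_subset_Icc_self hr)
  have hlim : Tendsto (fun n => (cbNorm K).toReal * u (n + 1) t X) atTop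
      (𝓝 ((cbNorm K).toReal * (‖B‖ * ((if Disjoint X Y then 0 else 1) +
        E t * ∑ x ∈ X, ∑ y ∈ Y, G x y) + c * 0 * ∑ x ∈ X, ∑ y ∈ Λ, G x y))) := by
    have h1 := (tendsto_add_atTop_iff_nat 1).mpr
      (FloorSemiring.tendsto_pow_div_factorial_atTop (N * C * (t - s)))
    exact (((h1.const_mul c).mul_const _).const_add _).const_mul _
  have := ge_of_tendsto' hlim fun n => step n (all n) X hX K hK hK1 t (Set.right_mem_Icc.mpr hst)
  rwa [mul_zero, zero_mul, add_zero] at this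

end Iteration

/-! ### Decay functions and the bound for the cocycle. -/

section Decay

variable {Γ : Type*} [MetricSpace Γ] {F : ℝ → ℝ} {μ : ℝ}

theorem IsDecayFunction.expWeight_pos (hF : IsDecayFunction Γ F) (x y : Γ) :
    0 < expWeight μ F (dist x y) :=
  mul_pos (Real.exp_pos _) (hF.pos _ dist_nonneg)

theorem IsDecayFunction.expWeight_le (hF : IsDecayFunction Γ F) (hμ : 0 < μ) (x y : Γ) :
    expWeight μ F (dist x y) ≤ F (dist x y) := by
  refine mul_le_of_le_one_left (hF.pos _ dist_nonneg).le (Real.exp_le_one_iff.mpr ?_)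
  nlinarith [dist_nonneg (x := x) (y := y)]

/-- By the triangle inequality the exponential factors of a convolution term are at most that of its
denominator, so the constant for `F` dominates. -/
theorem IsDecayFunction.convConst_expWeight_lt_top (hF : IsDecayFunction Γ F) (hμ : 0 < μ) :
    convConst Γ (expWeight μ F) < ∞ := by
  refine lt_of_le_of_lt ?_ hF.convConst_lt_top
  refine iSup_mono fun x => iSup_mono fun y => ENNReal.tsum_le_tsum fun z =>
    ENNReal.ofReal_le_ofReal ?_
  have h1 := hF.pos (dist x z) dist_nonneg
  have h2 := hF.pos (dist y z) dist_nonneg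
  have h3 := hF.pos (dist x y) dist_nonneg
  have h4 : Real.exp (-μ * dist x z) * Real.exp (-μ * dist y z) ≤ Real.exp (-μ * dist x y) := by
    rw [← Real.exp_add]
    refine Real.exp_le_exp.mpr ?_
    nlinarith [dist_triangle_right x y z]
  rw [div_le_div_iff₀ (hF.expWeight_pos x y) h3]
  calc expWeight μ F (dist x z) * expWeight μ F (dist y z) * F (dist x y)
      = Real.exp (-μ * dist x z) * Real.exp (-μ * dist y z) *
          (F (dist x z) * F (dist y z) * F (dist x y)) := by
        simp only [expWeight]
        ring
    _ ≤ Real.exp (-μ * dist x y) * (F (dist x z) * F (dist y z) * F (dist x y)) := by gcongr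
    _ = F (dist x z) * F (dist y z) * expWeight μ F (dist x y) := by
        simp only [expWeight]
        ring

theorem IsDecayFunction.sum_expWeight_mul_le (hF : IsDecayFunction Γ F) (hμ : 0 < μ)
    (Λ : Finset Γ) (x y : Γ) :
    ∑ z ∈ Λ, expWeight μ F (dist x z) * expWeight μ F (dist z y) ≤
      (convConst Γ (expWeight μ F)).toReal * expWeight μ F (dist x y) := by
  rw [← div_le_iff₀ (hF.expWeight_pos x y), Finset.sum_div,
    ← ENNReal.ofReal_le_iff_le_toReal (hF.convConst_expWeight_lt_top hμ).ne,
    ENNReal.ofReal_sum_of_nonneg fun z _ => (div_pos (mul_pos (hF.expWeight_pos x z)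
      (hF.expWeight_pos z y)) (hF.expWeight_pos x y)).le]
  refine le_trans (le_of_eq ?_) ((ENNReal.sum_le_tsum Λ).trans (le_iSup₂_of_le x y le_rfl))
  simp only [dist_comm y]

/-- The diagonal term `x = y = z` is already positive. -/
theorem IsDecayFunction.convConst_expWeight_pos [Nonempty Γ] (hF : IsDecayFunction Γ F)
    (hμ : 0 < μ) : 0 < (convConst Γ (expWeight μ F)).toReal := by
  obtain ⟨x⟩ := ‹Nonempty Γ›
  have h1 := hF.sum_expWeight_mul_le hμ {x} x x
  rw [Finset.sum_singleton] at h1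
  exact pos_of_mul_pos_left ((mul_pos (hF.expWeight_pos x x) (hF.expWeight_pos x x)).trans_le h1)
    (hF.expWeight_pos x x).le

theorem IsDecayFunction.sum_le_uniformSum (hF : IsDecayFunction Γ F) (Y : Finset Γ) (x : Γ) :
    ∑ y ∈ Y, F (dist x y) ≤ (uniformSum Γ F).toReal := by
  rw [← ENNReal.ofReal_le_iff_le_toReal hF.uniformSum_lt_top.ne,
    ENNReal.ofReal_sum_of_nonneg fun y _ => (hF.pos _ dist_nonneg).le]
  exact (ENNReal.sum_le_tsum Y).trans (le_iSup_of_le x le_rfl)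

theorem IsDecayFunction.sum_sum_le (hF : IsDecayFunction Γ F) (X Y : Finset Γ) :
    ∑ x ∈ X, ∑ y ∈ Y, F (dist x y) ≤ (uniformSum Γ F).toReal * (min X.card Y.card : ℕ) := by
  have key : ∀ X Y : Finset Γ, ∑ x ∈ X, ∑ y ∈ Y, F (dist x y) ≤
      (uniformSum Γ F).toReal * X.card := fun X Y => by
    refine (Finset.sum_le_card_nsmul X _ _ fun x _ => hF.sum_le_uniformSum Y x).trans_eq ?_
    rw [nsmul_eq_mul, mul_comm]
  rcases min_choice X.card Y.card with h | h <;> rw [h]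
  · exact key X Y
  · rw [Finset.sum_comm]
    simp only [dist_comm]
    exact key Y X

theorem setDist_le {X Y : Finset Γ} {x y : Γ} (hx : x ∈ X) (hy : y ∈ Y) :
    setDist X Y ≤ dist x y :=
  csInf_le ⟨0, by rintro _ ⟨x, _, y, _, rfl⟩; exact dist_nonneg⟩ ⟨x, hx, y, hy, rfl⟩

theorem IsDecayFunction.sum_sum_expWeight_le (hF : IsDecayFunction Γ F) (hμ : 0 < μ)
    (X Y : Finset Γ) : ∑ x ∈ X, ∑ y ∈ Y, expWeight μ F (dist x y) ≤
      Real.exp (-μ * setDist X Y) * ((uniformSum Γ F).toReal * (min X.card Y.card : ℕ)) := by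
  refine le_trans ?_ (mul_le_mul_of_nonneg_left (hF.sum_sum_le X Y) (Real.exp_pos _).le)
  simp only [Finset.mul_sum]
  refine Finset.sum_le_sum fun x hx => Finset.sum_le_sum fun y hy => ?_
  refine mul_le_mul_of_nonneg_right (Real.exp_le_exp.mpr ?_) (hF.pos _ dist_nonneg).le
  nlinarith [setDist_le hx hy]

variable [DecidableEq Γ] {H : Γ → Type*} [∀ x, NormedAddCommGroup (H x)]
  [∀ x, InnerProductSpace ℂ (H x)] [∀ x, CompleteSpace (H x)]

theorem LindbladFamily.sum_cbNorm_le (𝓛 : LindbladFamily H) (hF : IsDecayFunction Γ F)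
    {S : Set Γ} {t : ℝ} (hS : 𝓛.decayNorm F μ S t < ∞) {Λ : Finset Γ} (hΛ : (Λ : Set Γ) ⊆ S)
    {r : ℝ} (hr : r ∈ Set.Icc 0 t) {x y : Γ} (hx : x ∈ Λ) (hy : y ∈ Λ) :
    ∑ Z ∈ Λ.powerset with x ∈ Z ∧ y ∈ Z, (cbNorm (𝓛.Ψ r Z)).toReal ≤
      (𝓛.decayNorm F μ S t).toReal * expWeight μ F (dist x y) := by
  have hw := hF.expWeight_pos (μ := μ) x y
  rw [← div_le_iff₀ hw, ← ENNReal.ofReal_le_iff_le_toReal hS.ne, ENNReal.ofReal_div_of_pos hw,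
    ENNReal.ofReal_sum_of_nonneg fun _ _ => ENNReal.toReal_nonneg, ENNReal.div_eq_inv_mul,
    Finset.mul_sum]
  classical
  let ι : {Z // Z ∈ Λ.powerset.filter fun Z => x ∈ Z ∧ y ∈ Z} ↪
      {Z : Finset Γ // (Z : Set Γ) ⊆ S ∧ x ∈ Z ∧ y ∈ Z} :=
    ⟨fun Z => ⟨Z, (Finset.coe_subset.mpr (Finset.mem_powerset.mp
      (Finset.mem_filter.mp Z.2).1)).trans hΛ, (Finset.mem_filter.mp Z.2).2⟩,
      by
        rintro ⟨Z, _⟩ ⟨Z', _⟩ h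
        simpa using h⟩
  let T : Finset {Z : Finset Γ // (Z : Set Γ) ⊆ S ∧ x ∈ Z ∧ y ∈ Z} := Finset.univ.map ι
  have hT : ∑ Z ∈ Λ.powerset with x ∈ Z ∧ y ∈ Z, (ENNReal.ofReal (expWeight μ F (dist x y)))⁻¹ *
      ENNReal.ofReal (cbNorm (𝓛.Ψ r Z)).toReal =
      ∑ Z ∈ T, cbNorm (𝓛.Ψ r Z) / ENNReal.ofReal (expWeight μ F (dist x y)) := by
    rw [Finset.sum_map, ← Finset.sum_attach]
    refine Finset.sum_congr rfl fun Z _ => ?_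
    rw [ENNReal.ofReal_toReal (𝓛.completelyBounded r Z).ne, ENNReal.div_eq_inv_mul]
    rfl
  rw [hT]
  exact (ENNReal.sum_le_tsum T).trans (le_iSup₂_of_le r hr
    (le_iSup₂_of_le x (hΛ hx) (le_iSup₂_of_le y (hΛ hy) le_rfl)))

/-- The Lieb-Robinson bound with the weight `F_μ`; `C` is any positive convolution constant. -/
theorem LindbladFamily.norm_amplify_cocycle_le (𝓛 : LindbladFamily H) (hF : IsDecayFunction Γ F)
    {S : Set Γ} {s t : ℝ} (hS : 𝓛.decayNorm F μ S t < ∞) {Λ X Y : Finset Γ}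
    (hcont : Continuous (𝓛.generator Λ)) (hΛ : (Λ : Set Γ) ⊆ S) (hX : X ⊆ Λ) (hY : Y ⊆ Λ) {K : Obs H X →L[ℂ] Obs H X}
    (hK : cbNorm K < ∞) (hK1 : K 1 = 0) (B : Obs H Y) (hs : 0 ≤ s) (hst : s ≤ t) {C : ℝ}
    (hC0 : 0 < C) (hC : ∀ x ∈ Λ, ∀ y ∈ Λ, ∑ z ∈ Λ, expWeight μ F (dist x z) *
      expWeight μ F (dist z y) ≤ C * expWeight μ F (dist x y)) :
    ‖amplify hX K (𝓛.cocycle Λ t s (embed H hY B))‖ ≤ (cbNorm K).toReal *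
      (‖B‖ * ((if Disjoint X Y then 0 else 1) +
        (Real.exp ((𝓛.decayNorm F μ S t).toReal * C * (t - s)) - 1) / C *
          ∑ x ∈ X, ∑ y ∈ Y, expWeight μ F (dist x y))) := by
  obtain ⟨A, hA0, hA, hcoc⟩ := exists_propagator_eq (E := Obs H Λ) hcont s (embed H hY B)
  rw [LindbladFamily.cocycle, hcoc]
  exact 𝓛.norm_amplify_le_exp hX hY (fun x y => hF.expWeight_pos x y) ENNReal.toReal_nonneg hC0
    hst (fun r hr x hx y hy => 𝓛.sum_cbNorm_le hF hS hΛ ⟨hs.trans hr.1, hr.2.le⟩ hx hy) hC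
    hA0 hA hK hK1

end Decay

end LiebRobinson

end

theorem theorem3p3p1 {Γ : Type*} [MetricSpace Γ] [Countable Γ] [DecidableEq Γ]
    (H : Γ → Type*) [∀ x, NormedAddCommGroup (H x)] [∀ x, InnerProductSpace ℂ (H x)]
    [∀ x, CompleteSpace (H x)]
    (F : ℝ → ℝ) (hF : LiebRobinson.IsDecayFunction Γ F)
    (𝓛 : LiebRobinson.LindbladFamily H)
    (hcont : ∀ Λ : Finset Γ, Continuous (𝓛.generator Λ))
    (μ : ℝ) (hμ : 0 < μ) (S : Set Γ) (hS : ∀ t : ℝ, 𝓛.decayNorm F μ S t < ⊤)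
    (Λ X Y : Finset Γ) (hΛ : (Λ : Set Γ) ⊆ S) (hX : X ⊆ Λ) (hY : Y ⊆ Λ)
    (K : LiebRobinson.Obs H X →L[ℂ] LiebRobinson.Obs H X)
    (hKcb : LiebRobinson.cbNorm K < ⊤) (hK : K 1 = 0) (B : LiebRobinson.Obs H Y)
    (s t : ℝ) (hs : 0 ≤ s) (hst : s ≤ t) :
    -- the constant of the decay function, the norm of the generator, and the velocity
    let C : ℝ := (LiebRobinson.convConst Γ (LiebRobinson.expWeight μ F)).toReal
    let N : ℝ := (𝓛.decayNorm F μ S t).toReal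
    let v : ℝ := N * C / μ
    let k : ℝ := (LiebRobinson.cbNorm K).toReal
    let lhs : ℝ := ‖LiebRobinson.amplify hX K (𝓛.cocycle Λ t s (LiebRobinson.embed H hY B))‖
    -- arbitrary `X` and `Y`
    (lhs ≤ k * ‖B‖ * ((if Disjoint X Y then 0 else 1) +
      (Real.exp (N * C * |t - s|) - 1) / C * ∑ x ∈ X, ∑ y ∈ Y, F (dist x y))) ∧
    -- disjoint `X` and `Y`
    (Disjoint X Y →
      lhs ≤ k * ‖B‖ / C * Real.exp (N * C * |t - s|) * ∑ x ∈ X, ∑ y ∈ Y, F (dist x y) ∧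
      lhs ≤ k * ‖B‖ / C * Real.exp (N * C * |t - s|) *
        ∑ x ∈ X, ∑ y ∈ Y, LiebRobinson.expWeight μ F (dist x y) ∧
      lhs ≤ k * ‖B‖ / C * (LiebRobinson.uniformSum Γ F).toReal * (min X.card Y.card : ℕ) *
        Real.exp (-μ * (LiebRobinson.setDist X Y - v * |t - s|))) := by
  intro C N v k lhs
  have hts : |t - s| = t - s := abs_of_nonneg (sub_nonneg.mpr hst)
  have hk : 0 ≤ k := ENNReal.toReal_nonneg
  have hN : 0 ≤ N := ENNReal.toReal_nonneg
  have main := fun {c : ℝ} (hc0 : 0 < c) => 𝓛.norm_amplify_cocycle_le hF (hS t) (hcont Λ) hΛ hX hY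
    hKcb hK B hs hst hc0
  -- For empty `X` every right-hand side is zero. If `Γ` is empty too, then `C` is zero, so the
  -- estimate is applied with the constant `1`, for which the convolution condition is vacuous.
  rcases X.eq_empty_or_nonempty with rfl | ⟨x₀, _⟩
  · have h0 : lhs ≤ 0 := by
      rcases isEmpty_or_nonempty Γ with hΓ | hΓ
      · have := main one_pos fun x => hΓ.elim x
        simpa [lhs] using this
      · have := main (hF.convConst_expWeight_pos hμ) fun x _ y _ => hF.sum_expWeight_mul_le hμ Λ x y
        simpa [lhs] using this
    simpa using h0
  have : Nonempty Γ := ⟨x₀⟩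
  have hC : 0 < C := hF.convConst_expWeight_pos hμ
  have hmain := main hC fun x _ y _ => hF.sum_expWeight_mul_le hμ Λ x y
  have hNC : 0 ≤ N * C * (t - s) := mul_nonneg (mul_nonneg hN hC.le) (sub_nonneg.mpr hst)
  have hE : 0 ≤ (Real.exp (N * C * (t - s)) - 1) / C := by
    refine div_nonneg ?_ hC.le
    linarith [Real.add_one_le_exp (N * C * (t - s))]
  have hE' : (Real.exp (N * C * (t - s)) - 1) / C ≤ Real.exp (N * C * (t - s)) / C := by
    gcongr
    linarith
  have hw : ∑ x ∈ X, ∑ y ∈ Y, LiebRobinson.expWeight μ F (dist x y) ≤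
      ∑ x ∈ X, ∑ y ∈ Y, F (dist x y) :=
    Finset.sum_le_sum fun x _ => Finset.sum_le_sum fun y _ => hF.expWeight_le hμ x y
  have hw0 : 0 ≤ ∑ x ∈ X, ∑ y ∈ Y, LiebRobinson.expWeight μ F (dist x y) :=
    Finset.sum_nonneg fun x _ => Finset.sum_nonneg fun y _ => (hF.expWeight_pos x y).le
  rw [hts]
  refine ⟨hmain.trans ?_, fun hd => ?_⟩
  · rw [mul_assoc k]
    gcongr
  have hdisj : lhs ≤ k * ‖B‖ / C * Real.exp (N * C * (t - s)) *
      ∑ x ∈ X, ∑ y ∈ Y, LiebRobinson.expWeight μ F (dist x y) := by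
    refine hmain.trans ?_
    rw [if_pos hd, zero_add]
    calc _ ≤ k * (‖B‖ * (Real.exp (N * C * (t - s)) / C *
          ∑ x ∈ X, ∑ y ∈ Y, LiebRobinson.expWeight μ F (dist x y))) := by gcongr
      _ = _ := by ring
  refine ⟨hdisj.trans (by gcongr), hdisj, hdisj.trans ?_⟩
  calc _ ≤ k * ‖B‖ / C * Real.exp (N * C * (t - s)) *
        (Real.exp (-μ * LiebRobinson.setDist X Y) *
          ((LiebRobinson.uniformSum Γ F).toReal * (min X.card Y.card : ℕ))) := by
        gcongr
        exact hF.sum_sum_expWeight_le hμ X Y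
    _ = k * ‖B‖ / C * (LiebRobinson.uniformSum Γ F).toReal * (min X.card Y.card : ℕ) *
        (Real.exp (N * C * (t - s)) * Real.exp (-μ * LiebRobinson.setDist X Y)) := by ring
    _ = _ := by
        -- The velocity is chosen so that `μ v = N C`, which merges the two exponents.
        rw [← Real.exp_add]
        congr 2
        simp only [v]
        field_simp
        ring
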